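/- Let $K$ be a field, $n\ge 0$, $R=K[x_0,\dots,x_n]$ and $R^{(j)}=K[x_0,\dots,x_{n-j}]$ for $0\le j\le n$. A monomial ideal is *strongly stable* if $x^A\in I$, $x_j\mid x^A$ and $i<j$ imply $\frac{x_i}{x_j}x^A\in I$. A homogeneous ideal $I$ is *saturated* if $I:(x_0,\dots,x_n)^k=I$ for all $k$. For a monomial ideal $I$ let $G(I)$ be the set of its minimal monomial generators. *Expansions.* Let $I$ be a saturated strongly stable ideal of a ring $K[x_0,\dots,x_m]$. A monomial $x^A\ne1$ in $G(I)$ is *expandable* if no monomial $x^A\frac{x_{i+1}}{x_i}$ with $x_i\mid x^A$ and $0\le i<m-1$ belongs to $G(I)$. Its *expansion in $I$* is the ideal generated by $(G(I)\setminus\{x^A\})\cup\{x^Ax_r,x^Ax_{r+1},\dots,x^Ax_{m-1}\}$, where $r=\max\{i: x_i\mid x^A\}$. The expansion of $1$ in the unit ideal $(1)$ is $(x_0,\dots,x_{m-1})$. Let $I\subsetneq R$ be a saturated strongly stable ideal, let $p\in\mathbb Q[z]$ be the Hilbert polynomial of $R/I$, and let $d=\deg p$ (so $d\le n$). For $0\le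 j\le n$ let $I^{(j)}\subseteq R^{(j)}$ be the ideal generated by the monomials obtained from those in $G(I)$ by setting $x_{n-j}=\dots=x_{n-1}=1$ (no monomial in $G(I)$ involves $x_n$, and $I^{(0)}=I$). If $d<n$, then $I^{(d+1)}R^{(d)}=(1)=R^{(d)}$; if $d=n$, then we set $I^{(n+1)}R^{(n)}:=(1)=R^{(n)}$. Let $(\Delta p)(z)=p(z)-p(z-1)$ and $\Delta^j=\Delta\circ\dots\circ\Delta$ ($j$ times). There are unique integers $b_0\ge b_1\ge\dots\ge b_d>0$ with $$p(z)=\sum_{i=0}^d\left[\binom{z+i}{i+1}-\binom{z+i-b_i}{i+1}\right];$$ put $a_d=b_d$ and $a_j=b_j-b_{j+1}$ for $0\le j<d$. Then there is a finite sequence of expansions that takes the ideal $(1)=R^{(d)}$ to the ideal $I\subset R$. More precisely, for each $j=d,d-1,\dots,0$ the ideal $I^{(j)}$ is obtained from $I^{(j+1)}R^{(j)}$ by finitely many successive expansions in $R^{(j)}$. The number of expansions in $R^{(j)}$ needed for this is always the same, namely $$\Delta^jp(z)-p_{R^{(j)}/I^{(j+1)}R^{(j)}}(z),$$ where $p_{R^{(j)}/I^{(j+1)}R^{(j)}}$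 is the Hilbert polynomial of $R^{(j)}/I^{(j+1)}R^{(j)}$ (in particular, this difference is a constant), and it is at most $a_j$. The total number of expansions over $j=0,\dots,d$ is at most $b_0$. -/

import Mathlib

namespace StronglyStableIdeals

open MvPolynomial

noncomputable section

/-- The ideal generated by the monomials `x^A`, `A ∈ S`. -/
def monomialIdeal {K : Type*} [Field K] {m : ℕ} (S : Set (Fin (m + 1) →₀ ℕ)) :
    Ideal (MvPolynomial (Fin (m + 1)) K) :=
  Ideal.span ((fun A => monomial A (1 : K)) '' S)

/-- A monomial ideal `I` of `K[x_0, …, x_m]` is strongly stable if, for every monomial `x^A ∈ I`,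
every variable `x_j` dividing `x^A` and every `i < j`, also `(x_i / x_j) x^A ∈ I`. -/
def IsStronglyStable {K : Type*} [Field K] {m : ℕ}
    (I : Ideal (MvPolynomial (Fin (m + 1)) K)) : Prop :=
  (∃ S : Set (Fin (m + 1) →₀ ℕ), I = monomialIdeal S) ∧
    ∀ A : Fin (m + 1) →₀ ℕ, monomial A (1 : K) ∈ I →
      ∀ i j : Fin (m + 1), i < j → A j ≠ 0 →
        monomial (A - Finsupp.single j 1 + Finsupp.single i 1) (1 : K) ∈ I

/-- `I` is saturated: it contains every `f` that is multiplied into `I` by some power of the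
irrelevant ideal `(x_0, …, x_m)`. -/
def IsSaturated {K : Type*} [Field K] {m : ℕ}
    (I : Ideal (MvPolynomial (Fin (m + 1)) K)) : Prop :=
  ∀ (f : MvPolynomial (Fin (m + 1)) K) (k : ℕ),
    (∀ g ∈ (Ideal.span (Set.range X) : Ideal (MvPolynomial (Fin (m + 1)) K)) ^ k, g * f ∈ I) →
      f ∈ I

/-- The Hilbert function of the quotient by `I`: the dimension of the image in the quotient of
the forms of degree `k`. -/
def hilbertFunction {K : Type*} [Field K] {m : ℕ}
    (I : Ideal (MvPolynomial (Fin (m + 1)) K)) (k : ℕ) : ℕ :=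
  Module.finrank K
    ((homogeneousSubmodule (Fin (m + 1)) K k).map (Ideal.Quotient.mkₐ K I).toLinearMap)

/-- `p` is the Hilbert polynomial of the quotient by `I`. -/
def IsHilbertPolynomial {K : Type*} [Field K] {m : ℕ}
    (I : Ideal (MvPolynomial (Fin (m + 1)) K)) (p : Polynomial ℚ) : Prop :=
  ∃ k₀ : ℕ, ∀ k : ℕ, k₀ ≤ k → p.eval (k : ℚ) = (hilbertFunction I k : ℚ)

/-- The (exponents of the) minimal monomial generators `G(I)` of a monomial ideal `I`. -/
def minGens {K : Type*} [Field K] {m : ℕ} (I : Ideal (MvPolynomial (Fin (m + 1)) K)) :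
    Set (Fin (m + 1) →₀ ℕ) :=
  {A | Minimal (fun B : Fin (m + 1) →₀ ℕ => monomial B (1 : K) ∈ I) A}

/-- The right-shifts of `x^A` in `K[x_0, …, x_m]`: the monomials `x^A x_{i+1} / x_i` with
`x_i ∣ x^A` and `0 ≤ i < m - 1`. -/
def rightShifts {m : ℕ} (A : Fin (m + 1) →₀ ℕ) : Set (Fin (m + 1) →₀ ℕ) :=
  {B | ∃ i j : Fin (m + 1), (j : ℕ) = (i : ℕ) + 1 ∧ j < Fin.last m ∧ A i ≠ 0 ∧
    B = A - Finsupp.single i 1 + Finsupp.single j 1}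

/-- The monomial `x^A` is expandable in `I`: it is a minimal generator different from `1`, and
none of its right-shifts is a minimal generator. -/
def IsExpandable {K : Type*} [Field K] {m : ℕ}
    (I : Ideal (MvPolynomial (Fin (m + 1)) K)) (A : Fin (m + 1) →₀ ℕ) : Prop :=
  A ≠ 0 ∧ A ∈ minGens I ∧ minGens I ∩ rightShifts A = ∅

/-- The expansion of `x^A` in `I ⊆ K[x_0, …, x_m]`: in `G(I)`, the generator `x^A` is replaced by
`x^A x_r, x^A x_{r+1}, …, x^A x_{m-1}`, where `r` is the largest index of a variable dividing
`x^A`. -/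
def expansion {K : Type*} [Field K] {m : ℕ}
    (I : Ideal (MvPolynomial (Fin (m + 1)) K)) (A : Fin (m + 1) →₀ ℕ) :
    Ideal (MvPolynomial (Fin (m + 1)) K) :=
  monomialIdeal ((minGens I \ {A}) ∪
    {B | ∃ i : Fin (m + 1), (∀ k ∈ A.support, k ≤ i) ∧ i < Fin.last m ∧
      B = A + Finsupp.single i 1})

/-- `J` arises from `I` by one expansion: of an expandable monomial of `I`, or of the generator
`1` of the unit ideal of `K[x_0, …, x_m]`, whose expansion is `(x_0, …, x_{m-1})`. -/
def IsExpansion {K : Type*} [Field K] {m : ℕ}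
    (I J : Ideal (MvPolynomial (Fin (m + 1)) K)) : Prop :=
  (∃ A, IsExpandable I A ∧ J = expansion I A) ∨
    (I = ⊤ ∧ J = Ideal.span {f | ∃ i : Fin (m + 1), i < Fin.last m ∧ f = X i})

/-- `J` arises from `I` by exactly `N` successive expansions in `K[x_0, …, x_m]`. -/
def ReachedByExpansions {K : Type*} [Field K] {m : ℕ} (N : ℕ)
    (I J : Ideal (MvPolynomial (Fin (m + 1)) K)) : Prop :=
  ∃ c : ℕ → Ideal (MvPolynomial (Fin (m + 1)) K),
    c 0 = I ∧ c N = J ∧ ∀ i < N, IsExpansion (c i) (c (i + 1))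

/-- The substitution `x_{n-j} = … = x_n = 1` from `K[x_0, …, x_n]` to
`R^{(j)} = K[x_0, …, x_{n-j}]`. -/
def setOne {K : Type*} [Field K] {n : ℕ} (j : ℕ) :
    MvPolynomial (Fin (n + 1)) K →ₐ[K] MvPolynomial (Fin (n - j + 1)) K :=
  aeval fun i : Fin (n + 1) =>
    if h : (i : ℕ) < n - j then X (⟨i, Nat.lt_succ_of_lt h⟩ : Fin (n - j + 1)) else 1

/-- The ideal `I^{(j)}` of `R^{(j)} = K[x_0, …, x_{n-j}]`, generated by what the minimal monomial
generators of `I` become under `x_{n-j} = … = x_{n-1} = 1`. (The ideal `I` is meant to be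
saturated and strongly stable; its minimal generators then do not involve `x_n`.) For `j > n`,
where no projective space is left, `I^{(j)}` is the unit ideal by convention; this is only
used for `j = n + 1`. -/
def idealAt {K : Type*} [Field K] {n : ℕ} (I : Ideal (MvPolynomial (Fin (n + 1)) K)) (j : ℕ) :
    Ideal (MvPolynomial (Fin (n - j + 1)) K) :=
  if j ≤ n then Ideal.span ((fun A => setOne j (monomial A (1 : K))) '' minGens I) else ⊤

/-- The extension ideal `I^{(j+1)} R^{(j)}`. -/
def extendedIdealAt {K : Type*} [Field K] {n : ℕ} (I : Ideal (MvPolynomial (Fin (n + 1)) K))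
    (j : ℕ) : Ideal (MvPolynomial (Fin (n - j + 1)) K) :=
  (idealAt I (j + 1)).map
    (rename (Fin.castLE (by omega : n - (j + 1) + 1 ≤ n - j + 1)) :
      MvPolynomial (Fin (n - (j + 1) + 1)) K →ₐ[K] MvPolynomial (Fin (n - j + 1)) K)

/-- The difference operator `(Δ p)(z) = p(z) - p(z - 1)`. -/
def backwardDiff (p : Polynomial ℚ) : Polynomial ℚ :=
  p - p.comp (Polynomial.X - 1)

/-- The binomial coefficient `(z + c choose m)`, as a polynomial in `z`. -/
def binomPoly (c : ℤ) (m : ℕ) : Polynomial ℚ :=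
  Polynomial.C ((m.factorial : ℚ)⁻¹) *
    ∏ k ∈ Finset.range m, (Polynomial.X + Polynomial.C ((c : ℚ) - (k : ℚ)))

/-- `b_0 ≥ b_1 ≥ … ≥ b_d > 0` are integers with
`p(z) = ∑_{i=0}^d [(z + i choose i + 1) - (z + i - b_i choose i + 1)]`;
as a sequence, `b` is continued by `b_i = 0` for `i > d`. -/
def IsMacaulayRepresentation (p : Polynomial ℚ) (d : ℕ) (b : ℕ → ℤ) : Prop :=
  (∀ i < d, b (i + 1) ≤ b i) ∧ 0 < b d ∧ (∀ i, d < i → b i = 0) ∧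
    p = ∑ i ∈ Finset.range (d + 1),
      (binomPoly (i : ℤ) (i + 1) - binomPoly ((i : ℤ) - b i) (i + 1))

end

end StronglyStableIdeals

/-!
A saturated strongly stable ideal `I` of `K[x_0, …, x_m]` is determined by the set `U` of exponents
of its monomials. Such a *Borel set* is closed under multiplication, under replacing a variable by
an earlier one, and under cancelling `x_m` (`exists_isBorel`). In these terms an expansion of `x^A`
deletes from `U` just the exponents of the monomials `x^A x_m^t`, and every deletion of this kind
that leaves a Borel set is an expansion (`isExpansion_iff`). So an expansion raises the Hilbert
function by one in all degrees `≥ |A|`, which makes the number of expansions between two ideals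
unique.

If `W ⊆ V` are Borel sets and `V \ W` is finite up to the last variable, then a monomial of
`V \ W` of least weight, where `x_i` has weight `m + 1 - i`, can be removed from `V`: its proper
divisors and its shifts to the right have smaller weight. Hence `W` is reached from `V` by
expansions (`exists_expansions`). The strongly stable property provides this finiteness for the
exponent sets of `I^{(j)} ⊆ I^{(j+1)} R^{(j)}` (`finite_extendedShadow_diff`).

For the bounds, note that a monomial expanded in `R^{(j)}` contributes to the complement of `I` a
cone `x^A K[x_{n-j}, …, x_n]` over `j + 1` variables. Thus the Hilbert polynomial is a sum of cone
polynomials `binom (z - e + j, j)`, and applying `Δ` removes one variable from each cone, which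
gives the formula for the number of expansions. An expansion raises the largest degree of a
generator by at most one, so the apex degree `e` of each cone is at most the number of cones before
it, the dimension `j` decreasing from `n`. The Macaulay representation is a sum of the same type in
which all these inequalities are equalities. By Pascal's rule, raising the degree of the apex of
a cone to its position splits off cones with one variable less only. Doing this for `j = n, …, 0`
ends with the Macaulay representation, which therefore has at least as many cones over `j + 1`
variables as there are expansions in `R^{(j)}` (`exists_rearrangement`); that is, the number of
these expansions is at most `b_j - b_{j+1} = a_j`. The integers `b_i` are unique because `Δ` shifts
the sequence and the term `i = 0` is the constant `b_0` (`macaulay_sum_injective`).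
-/

namespace StronglyStableIdeals

open MvPolynomial

noncomputable section

/-! ### Exponent sets of saturated strongly stable ideals -/

section BorelSets

/-- The exponent set of a saturated strongly stable ideal of `K[x_0, …, x_m]`: it is closed under
multiplication by monomials, under replacing a variable by an earlier one, and under cancelling the
last variable. For a strongly stable ideal, the last condition amounts to saturation. -/
structure IsBorel {m : ℕ} (U : Set (Fin (m + 1) →₀ ℕ)) : Prop where
  add_mem : ∀ A B, A ∈ U → A + B ∈ U
  shift_mem : ∀ A i j, i < j → A + Finsupp.single j 1 ∈ U → A + Finsupp.single i 1 ∈ U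
  cancel_last : ∀ A, A + Finsupp.single (Fin.last m) 1 ∈ U → A ∈ U

/-- The exponents `A + t e_m`, `t ≥ 0`, of the monomials `x^A x_m^t`. -/
def lastRay {m : ℕ} (A : Fin (m + 1) →₀ ℕ) : Set (Fin (m + 1) →₀ ℕ) :=
  {B | ∃ t : ℕ, B = A + Finsupp.single (Fin.last m) t}

/-- A minimal element `A` of `U` is removable if no monomial `x^A x_j / x_i` with `i < j < m`
has its exponent in `U`. In contrast to the definition of an expandable monomial, all shifts to the
right are considered, not only those to the next variable, and `A = 0` is allowed. -/
def IsRemovable {m : ℕ} (U : Set (Fin (m + 1) →₀ ℕ)) (A : Fin (m + 1) →₀ ℕ) : Prop :=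
  Minimal (· ∈ U) A ∧ ∀ C i j, i < j → j < Fin.last m → A = C + Finsupp.single i 1 →
    C + Finsupp.single j 1 ∉ U

/-- Every element of `U` lies above an element of `U` of degree at most `g`: the minimal generators
have degree at most `g`. -/
def GeneratedInDegreeLE {m : ℕ} (U : Set (Fin (m + 1) →₀ ℕ)) (g : ℕ) : Prop :=
  ∀ B ∈ U, ∃ A ∈ U, A ≤ B ∧ A.degree ≤ g

/-- The number of monomials of degree `k` whose exponent is not in `U`. -/
def complCount {m : ℕ} (U : Set (Fin (m + 1) →₀ ℕ)) (k : ℕ) : ℕ :=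
  {B : Fin (m + 1) →₀ ℕ | B.degree = k ∧ B ∉ U}.ncard

variable {m : ℕ} {U V W : Set (Fin (m + 1) →₀ ℕ)} {A B : Fin (m + 1) →₀ ℕ}

theorem finite_complCount_set (U : Set (Fin (m + 1) →₀ ℕ)) (k : ℕ) :
    {B : Fin (m + 1) →₀ ℕ | B.degree = k ∧ B ∉ U}.Finite :=
  (Finsupp.finite_of_degree_eq k).subset fun _ hB => hB.1

theorem exists_add_single_of_apply_ne_zero {i : Fin (m + 1)} (h : A i ≠ 0) :
    ∃ C, A = C + Finsupp.single i 1 :=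
  ⟨A - Finsupp.single i 1, (tsub_add_cancel_of_le
    (Finsupp.single_le_iff.2 (Nat.one_le_iff_ne_zero.2 h))).symm⟩

theorem eq_erase_add_single (A : Fin (m + 1) →₀ ℕ) (i : Fin (m + 1)) :
    A = A.erase i + Finsupp.single i (A i) :=
  (Finsupp.erase_add_single i A).symm

theorem IsBorel.mem_of_le (hU : IsBorel U) (hA : A ∈ U) (h : A ≤ B) : B ∈ U := by
  obtain ⟨C, rfl⟩ := exists_add_of_le h
  exact hU.add_mem A C hA

theorem IsBorel.shift_mem_le (hU : IsBorel U) {i j : Fin (m + 1)} (hij : i ≤ j)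
    (hA : A + Finsupp.single j 1 ∈ U) : A + Finsupp.single i 1 ∈ U := by
  rcases hij.eq_or_lt with rfl | h
  · exact hA
  · exact hU.shift_mem A i j h hA

theorem IsBorel.cancel_single_last (hU : IsBorel U) (t : ℕ)
    (hA : A + Finsupp.single (Fin.last m) t ∈ U) : A ∈ U := by
  induction t with
  | zero => simpa using hA
  | succ t ih =>
    rw [Finsupp.single_add, ← add_assoc] at hA
    exact ih (hU.cancel_last _ hA)

theorem IsBorel.erase_last_mem (hU : IsBorel U) (hA : A ∈ U) : A.erase (Fin.last m) ∈ U := by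
  rw [eq_erase_add_single A (Fin.last m)] at hA
  exact hU.cancel_single_last _ hA

theorem IsBorel.apply_last_of_minimal (hU : IsBorel U) (hA : Minimal (· ∈ U) A) :
    A (Fin.last m) = 0 := by
  have h := hA.eq_of_le (hU.erase_last_mem hA.prop)
    (le_of_le_of_eq (self_le_add_right _ _) (eq_erase_add_single A (Fin.last m)).symm)
  have := DFunLike.congr_fun h (Fin.last m)
  simpa using this.symm

theorem isBorel_univ : IsBorel (Set.univ : Set (Fin (m + 1) →₀ ℕ)) :=
  ⟨fun _ _ _ => trivial, fun _ _ _ _ _ => trivial, fun _ _ => trivial⟩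

theorem exists_minimal_le (hB : B ∈ U) : ∃ A ≤ B, Minimal (· ∈ U) A :=
  exists_minimal_le_of_wellFoundedLT (· ∈ U) B hB

/-- If `B ∈ U` divides some `x^A x_m^t` with `A` minimal, then `B = A + s e_m` for some `s`. -/
theorem IsBorel.mem_lastRay_of_le (hU : IsBorel U) (hA : Minimal (· ∈ U) A) (hB : B ∈ U) {t : ℕ}
    (h : B ≤ A + Finsupp.single (Fin.last m) t) : B ∈ lastRay A := by
  have hle : B.erase (Fin.last m) ≤ A := by
    intro i
    by_cases hi : i = Fin.last m
    · simp [hi]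
    · have := h i
      simpa [Finsupp.erase_ne hi, Finsupp.single_eq_of_ne hi] using this
  rw [← hA.eq_of_le (hU.erase_last_mem hB) hle]
  exact ⟨B (Fin.last m), eq_erase_add_single _ _⟩

/-! ### Removing a monomial -/

theorem IsBorel.diff_lastRay (hU : IsBorel U) (hA : IsRemovable U A) : IsBorel (U \ lastRay A) where
  add_mem B C hB := by
    refine ⟨hU.add_mem B C hB.1, ?_⟩
    rintro ⟨t, ht⟩
    exact hB.2 (hU.mem_lastRay_of_le hA.1 hB.1 (ht ▸ self_le_add_right B C))
  shift_mem B i j hij hB := by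
    refine ⟨hU.shift_mem B i j hij hB.1, ?_⟩
    rintro ⟨t, ht⟩
    have hi : i ≠ Fin.last m := (hij.trans_le (Fin.le_last j)).ne
    have hAi : A i ≠ 0 := by
      have := DFunLike.congr_fun ht i
      simp [Finsupp.single_eq_of_ne hi] at this
      omega
    obtain ⟨C, hC⟩ := exists_add_single_of_apply_ne_zero hAi
    have hBC : B = C + Finsupp.single (Fin.last m) t := by
      rw [hC, add_right_comm] at ht
      exact add_right_cancel ht
    have hmem : C + Finsupp.single j 1 ∈ U := by
      apply hU.cancel_single_last t
      rw [add_right_comm, ← hBC]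
      exact hB.1
    rcases (Fin.le_last j).eq_or_lt with hj | hj
    · subst hj
      have h := hA.1.eq_of_le (hU.cancel_last _ hmem) (by rw [hC]; exact self_le_add_right _ _)
      rw [hC] at h
      simpa using DFunLike.congr_fun h i
    · exact hA.2 C i j hij hj hC hmem
  cancel_last B hB := by
    refine ⟨hU.cancel_last B hB.1, ?_⟩
    rintro ⟨t, rfl⟩
    exact hB.2 ⟨t + 1, by rw [Finsupp.single_add, add_assoc]⟩

theorem complCount_diff_lastRay (hU : IsBorel U) (hA : A ∈ U) (k : ℕ) :
    complCount (U \ lastRay A) k = complCount U k + if A.degree ≤ k then 1 else 0 := by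
  unfold complCount
  split_ifs with h
  · have : {B : Fin (m + 1) →₀ ℕ | B.degree = k ∧ B ∉ U \ lastRay A} =
        insert (A + Finsupp.single (Fin.last m) (k - A.degree))
          {B : Fin (m + 1) →₀ ℕ | B.degree = k ∧ B ∉ U} := by
      ext B
      simp only [Set.mem_ofPred_eq, Set.mem_sdiff, not_and_not_right, Set.mem_insert_iff]
      constructor
      · rintro ⟨hk, hB⟩
        by_cases hBU : B ∈ U
        · obtain ⟨t, rfl⟩ := hB hBU
          left
          rw [map_add, Finsupp.degree_single] at hk
          rw [← hk, Nat.add_sub_cancel_left]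
        · exact Or.inr ⟨hk, hBU⟩
      · rintro (rfl | ⟨hk, hB⟩)
        · refine ⟨?_, fun _ => ⟨_, rfl⟩⟩
          rw [map_add, Finsupp.degree_single]
          omega
        · exact ⟨hk, fun h => absurd h hB⟩
    rw [this, Set.ncard_insert_of_notMem _ (finite_complCount_set U k)]
    exact fun h => h.2 (hU.add_mem _ _ hA)
  · congr 1
    ext B
    simp only [Set.mem_ofPred_eq, Set.mem_sdiff, not_and_not_right]
    refine ⟨fun hB => ⟨hB.1, fun hBU => ?_⟩, fun hB => ⟨hB.1, fun h => absurd h hB.2⟩⟩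
    obtain ⟨t, rfl⟩ := hB.2 hBU
    apply h
    rw [← hB.1, map_add]
    exact Nat.le_add_right _ _

theorem GeneratedInDegreeLE.degree_le {g : ℕ} (h : GeneratedInDegreeLE U g)
    (hA : Minimal (· ∈ U) A) : A.degree ≤ g := by
  obtain ⟨B, hB, hBA, hBg⟩ := h A hA.prop
  rwa [hA.eq_of_le hB hBA] at hBg

theorem exists_lt_last_of_notMem_lastRay (hle : A ≤ B) (hB : B ∉ lastRay A) :
    ∃ i, i < Fin.last m ∧ A + Finsupp.single i 1 ≤ B := by
  obtain ⟨C, rfl⟩ := exists_add_of_le hle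
  by_contra! hcon
  apply hB
  refine ⟨C (Fin.last m), ?_⟩
  congr 1
  ext i
  by_cases hi : i = Fin.last m
  · simp [hi]
  · rw [Finsupp.single_eq_of_ne hi]
    by_contra hC
    refine hcon i (lt_of_le_of_ne (Fin.le_last i) hi) ?_
    gcongr
    exact Finsupp.single_le_iff.2 (Nat.one_le_iff_ne_zero.2 hC)

theorem add_single_notMem_lastRay {i : Fin (m + 1)} (hi : i < Fin.last m) :
    A + Finsupp.single i 1 ∉ lastRay A := by
  rintro ⟨t, ht⟩
  have := DFunLike.congr_fun ht i
  simp [Finsupp.single_eq_of_ne hi.ne] at this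

theorem GeneratedInDegreeLE.diff_lastRay {g : ℕ} (hU : IsBorel U)
    (h : GeneratedInDegreeLE U g) (hA : Minimal (· ∈ U) A) :
    GeneratedInDegreeLE (U \ lastRay A) (g + 1) := by
  rintro B ⟨hB, hBA⟩
  obtain ⟨D, hD, hDB, hDg⟩ := h B hB
  by_cases hDA : D ∈ lastRay A
  · obtain ⟨t, rfl⟩ := hDA
    obtain ⟨i, hi, hle⟩ := exists_lt_last_of_notMem_lastRay
      ((self_le_add_right _ _).trans hDB) hBA
    refine ⟨_, ⟨hU.add_mem _ _ hA.prop, add_single_notMem_lastRay hi⟩, hle, ?_⟩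
    rw [map_add, Finsupp.degree_single]
    exact Nat.add_le_add_right (h.degree_le hA) 1
  · exact ⟨D, ⟨hD, hDA⟩, hDB, hDg.trans (Nat.le_succ g)⟩

/-- Between two distinct Borel sets there is always a removable monomial: one of least weight in the
difference, where `x_i` has weight `m + 1 - i`. -/
theorem exists_isRemovable (hW : IsBorel W) (hWV : W ⊆ V)
    (hne : V ≠ W) : ∃ A, A ∉ W ∧ IsRemovable V A := by
  have hex : ∃ A, A ∈ V \ W := by
    by_contra! hcon
    exact hne (Set.Subset.antisymm (fun A hA => by_contra fun h => hcon A ⟨hA, h⟩) hWV)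
  let w : (Fin (m + 1) →₀ ℕ) → ℕ := fun A => ∑ i : Fin (m + 1), A i * (m + 1 - (i : ℕ))
  have hw_add : ∀ (A : Fin (m + 1) →₀ ℕ) (i : Fin (m + 1)),
      w (A + Finsupp.single i 1) = w A + (m + 1 - (i : ℕ)) := by
    intro A i
    simp only [w, Finsupp.add_apply, add_mul, Finset.sum_add_distrib]
    congr 1
    rw [Finset.sum_eq_single i]
    · simp
    · intro b _ hb
      simp [Finsupp.single_eq_of_ne hb]
    · simp
  have hw_mono : ∀ A B, A ≤ B → w A ≤ w B := fun A B h =>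
    Finset.sum_le_sum fun i _ => Nat.mul_le_mul_right _ (h i)
  obtain ⟨A, ⟨hAV, hAW⟩, hmin⟩ :=
    exists_minimalFor_of_wellFoundedLT (· ∈ V \ W) w hex
  have hmin' : ∀ B ∈ V \ W, w A ≤ w B := fun B hB => by
    by_contra! hlt
    exact absurd (hmin hB hlt.le) (not_le.2 hlt)
  refine ⟨A, hAW, ⟨hAV, fun D hD hDA => ?_⟩, fun C i j hij _ hC hmem => ?_⟩
  · by_contra hnot
    have hlt : D < A := lt_of_le_not_ge hDA hnot
    have : ∃ i, D i < A i := by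
      by_contra! hcon
      exact hnot hcon
    obtain ⟨i, hi⟩ := this
    have hD' : D + Finsupp.single i 1 ≤ A := by
      intro l
      by_cases hl : l = i
      · subst hl
        simpa using hi
      · simpa [Finsupp.single_eq_of_ne hl] using hDA l
    have h1 := hmin' D ⟨hD, fun h => hAW (hW.mem_of_le h hDA)⟩
    have h2 := hw_mono _ _ hD'
    rw [hw_add] at h2
    have := i.2
    omega
  · have h1 := hmin' _ ⟨hmem, fun h => hAW (hC ▸ hW.shift_mem C i j hij h)⟩
    rw [hC, hw_add, hw_add] at h1
    have hij' : (i : ℕ) < j := hij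
    have := j.2
    omega

end BorelSets

/-! ### Monomial ideals and their Hilbert functions -/

section MonomialIdeals

variable {K : Type*} [Field K] {m : ℕ} {U V W S T : Set (Fin (m + 1) →₀ ℕ)}
  {A B : Fin (m + 1) →₀ ℕ}

theorem mem_monomialIdeal {f : MvPolynomial (Fin (m + 1)) K} :
    f ∈ monomialIdeal S ↔ ∀ B ∈ f.support, ∃ A ∈ S, A ≤ B :=
  mem_ideal_span_monomial_image

theorem monomial_mem_monomialIdeal :
    monomial B (1 : K) ∈ monomialIdeal S ↔ ∃ A ∈ S, A ≤ B := by
  rw [mem_monomialIdeal]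
  simp

theorem IsBorel.monomial_mem_iff (hU : IsBorel U) :
    monomial B (1 : K) ∈ monomialIdeal U ↔ B ∈ U := by
  rw [monomial_mem_monomialIdeal]
  exact ⟨fun ⟨A, hA, hAB⟩ => hU.mem_of_le hA hAB, fun h => ⟨B, h, le_rfl⟩⟩

theorem monomialIdeal_congr (h : ∀ B, (∃ A ∈ S, A ≤ B) ↔ ∃ A ∈ T, A ≤ B) :
    (monomialIdeal S : Ideal (MvPolynomial (Fin (m + 1)) K)) = monomialIdeal T := by
  ext f
  simp only [mem_monomialIdeal, h]

theorem IsBorel.monomialIdeal_eq (hU : IsBorel U) (h : ∀ B, (∃ A ∈ S, A ≤ B) ↔ B ∈ U) :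
    (monomialIdeal S : Ideal (MvPolynomial (Fin (m + 1)) K)) = monomialIdeal U :=
  monomialIdeal_congr fun B => (h B).trans
    ⟨fun hB => ⟨B, hB, le_rfl⟩, fun ⟨_, hA, hAB⟩ => hU.mem_of_le hA hAB⟩

theorem IsBorel.minGens_eq (hU : IsBorel U) :
    minGens (monomialIdeal U : Ideal (MvPolynomial (Fin (m + 1)) K)) =
      {A | Minimal (· ∈ U) A} := by
  unfold minGens
  simp only [hU.monomial_mem_iff]

theorem monomialIdeal_injOn (hU : IsBorel U) (hV : IsBorel V)
    (h : (monomialIdeal U : Ideal (MvPolynomial (Fin (m + 1)) K)) = monomialIdeal V) :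
    U = V := by
  ext B
  rw [← hU.monomial_mem_iff (K := K), h, hV.monomial_mem_iff]

theorem monomialIdeal_univ :
    (monomialIdeal Set.univ : Ideal (MvPolynomial (Fin (m + 1)) K)) = ⊤ := by
  rw [Ideal.eq_top_iff_one]
  exact (isBorel_univ.monomial_mem_iff (B := 0)).2 trivial

/-- A saturated strongly stable ideal is spanned by the monomials in it, and their exponents form
a Borel set. -/
theorem exists_isBorel {I : Ideal (MvPolynomial (Fin (m + 1)) K)} (hsat : IsSaturated I)
    (hstable : IsStronglyStable I) :
    ∃ U : Set (Fin (m + 1) →₀ ℕ), IsBorel U ∧ I = monomialIdeal U := by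
  obtain ⟨⟨S, hS⟩, hst⟩ := hstable
  have hadd : ∀ A B : Fin (m + 1) →₀ ℕ, monomial A (1 : K) ∈ I → monomial (A + B) (1 : K) ∈ I := by
    intro A B hA
    have : monomial (A + B) (1 : K) = monomial B 1 * monomial A 1 := by
      rw [monomial_mul, one_mul, add_comm B A]
    rw [this]
    exact I.mul_mem_left _ hA
  have hshift : ∀ (A : Fin (m + 1) →₀ ℕ) (i j : Fin (m + 1)), i < j →
      monomial (A + Finsupp.single j 1) (1 : K) ∈ I →
      monomial (A + Finsupp.single i 1) (1 : K) ∈ I := by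
    intro A i j hij hA
    have := hst _ hA i j hij (by simp)
    rwa [add_tsub_cancel_right] at this
  have hU : IsBorel {A : Fin (m + 1) →₀ ℕ | monomial A (1 : K) ∈ I} := by
    refine ⟨hadd, hshift, fun A hA => ?_⟩
    -- `x^A` times any variable lies in the ideal, so saturation with exponent `1` applies
    refine hsat _ 1 fun g hg => ?_
    rw [pow_one] at hg
    have hle : (Ideal.span (Set.range X) : Ideal (MvPolynomial (Fin (m + 1)) K)) ≤
        I.colon {monomial A (1 : K)} := by
      rw [Ideal.span_le]
      rintro _ ⟨i, rfl⟩
      rw [SetLike.mem_coe, Submodule.mem_colon_singleton]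
      have hmem : monomial (A + Finsupp.single i 1) (1 : K) ∈ I := by
        rcases (Fin.le_last i).eq_or_lt with rfl | hi
        · exact hA
        · exact hshift A i _ hi hA
      have : (X i : MvPolynomial (Fin (m + 1)) K) • monomial A (1 : K) =
          monomial (A + Finsupp.single i 1) (1 : K) := by
        rw [smul_eq_mul, X, monomial_mul, one_mul, add_comm _ A]
      rwa [this]
    exact Submodule.mem_colon_singleton.1 (hle hg)
  refine ⟨_, hU, hS.trans (hU.monomialIdeal_eq fun B => ?_)⟩
  rw [Set.mem_ofPred_eq, hS, monomial_mem_monomialIdeal]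

theorem IsBorel.hilbertFunction_eq (hU : IsBorel U) (k : ℕ) :
    hilbertFunction (monomialIdeal U : Ideal (MvPolynomial (Fin (m + 1)) K)) k =
      complCount U k := by
  set I : Ideal (MvPolynomial (Fin (m + 1)) K) := monomialIdeal U with hI
  let ι := {B : Fin (m + 1) →₀ ℕ // B.degree = k ∧ B ∉ U}
  have : Finite ι := (finite_complCount_set U k).to_subtype
  have : Fintype ι := Fintype.ofFinite ι
  let v : ι → MvPolynomial (Fin (m + 1)) K ⧸ I :=
    fun B => (Ideal.Quotient.mkₐ K I).toLinearMap (monomial B.1 1)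
  have hli : LinearIndependent K v := by
    rw [Fintype.linearIndependent_iff]
    intro g hg i
    have hmem : ∑ B : ι, g B • monomial B.1 (1 : K) ∈ I := by
      rw [← Ideal.Quotient.eq_zero_iff_mem]
      have : (Ideal.Quotient.mkₐ K I).toLinearMap (∑ B : ι, g B • monomial B.1 (1 : K)) = 0 := by
        rw [map_sum, ← hg]
        exact Finset.sum_congr rfl fun B _ => map_smul _ _ _
      exact this
    have hcoeff : coeff i.1 (∑ B : ι, g B • monomial B.1 (1 : K)) = g i := by
      rw [coeff_sum, Finset.sum_eq_single i]
      · simp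
      · intro b _ hb
        have : b.1 ≠ i.1 := fun h => hb (Subtype.ext h)
        simp [coeff_monomial, this]
      · simp
    by_contra hne
    obtain ⟨A, hA, hAi⟩ := mem_monomialIdeal.1 hmem i.1 (by rwa [mem_support_iff, hcoeff])
    exact i.2.2 (hU.mem_of_le hA hAi)
  have hspan : (homogeneousSubmodule (Fin (m + 1)) K k).map
      (Ideal.Quotient.mkₐ K I).toLinearMap = Submodule.span K (Set.range v) := by
    apply le_antisymm
    · rintro _ ⟨f, hf, rfl⟩
      rw [f.as_sum, map_sum]
      refine Submodule.sum_mem _ fun B hB => ?_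
      have hmon : monomial B (coeff B f) = coeff B f • monomial B (1 : K) := by
        rw [smul_monomial, smul_eq_mul, mul_one]
      rw [hmon, map_smul]
      refine Submodule.smul_mem _ _ ?_
      by_cases hBU : B ∈ U
      · have : (Ideal.Quotient.mkₐ K I).toLinearMap (monomial B (1 : K)) = 0 :=
          Ideal.Quotient.eq_zero_iff_mem.2 (hU.monomial_mem_iff.2 hBU)
        rw [this]
        exact Submodule.zero_mem _
      · refine Submodule.subset_span ⟨⟨B, ?_, hBU⟩, rfl⟩
        have := (mem_homogeneousSubmodule k f).1 hf (mem_support_iff.1 hB)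
        exact (DFunLike.congr_fun Finsupp.degree_eq_weight_one B).trans this
    · rw [Submodule.span_le]
      rintro _ ⟨B, rfl⟩
      refine ⟨monomial B.1 1, ?_, rfl⟩
      exact (mem_homogeneousSubmodule k _).2 (isHomogeneous_monomial 1 B.2.1)
  rw [hilbertFunction, hspan, finrank_span_eq_card hli, ← Nat.card_eq_fintype_card]
  rfl

/-! ### Expansions as removals of monomials -/

theorem IsRemovable.isExpandable (hU : IsBorel U) (hA : IsRemovable U A) (hA0 : A ≠ 0) :
    IsExpandable (monomialIdeal U : Ideal (MvPolynomial (Fin (m + 1)) K)) A := by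
  refine ⟨hA0, by rw [hU.minGens_eq]; exact hA.1, ?_⟩
  rw [hU.minGens_eq, Set.eq_empty_iff_forall_notMem]
  rintro B ⟨hB, i, j, hij, hj, hi, rfl⟩
  obtain ⟨C, rfl⟩ := exists_add_single_of_apply_ne_zero hi
  rw [Set.mem_ofPred_eq, add_tsub_cancel_right] at hB
  exact hA.2 C i j (Fin.lt_def.2 (by omega)) hj rfl hB.prop

theorem IsExpandable.isRemovable (hU : IsBorel U)
    (h : IsExpandable (monomialIdeal U : Ideal (MvPolynomial (Fin (m + 1)) K)) A) :
    IsRemovable U A := by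
  obtain ⟨-, hmin, hempty⟩ := h
  rw [hU.minGens_eq] at hmin hempty
  refine ⟨hmin, ?_⟩
  rintro C i j hij hj rfl hmem
  have hi : (i : ℕ) + 1 < m + 1 := by
    have : (i : ℕ) < j := hij
    have := j.2
    omega
  have hle : (⟨i + 1, hi⟩ : Fin (m + 1)) ≤ j := Fin.le_def.2 (Nat.succ_le_of_lt hij)
  -- shifting back from `x_j` to `x_{i+1}` stays in `U`, and yields a minimal element of `U`
  have hmem' := hU.shift_mem_le hle hmem
  have hlt : i < (⟨i + 1, hi⟩ : Fin (m + 1)) := Fin.lt_def.2 (Nat.lt_succ_self _)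
  generalize hs : (⟨i + 1, hi⟩ : Fin (m + 1)) = s at hle hmem' hlt
  have hmin' : Minimal (· ∈ U) (C + Finsupp.single s 1) := by
    refine ⟨hmem', fun D hD hDle => ?_⟩
    have hCU : C ∉ U := fun hC => by
      have := hmin.eq_of_le hC (self_le_add_right _ _)
      simpa using DFunLike.congr_fun this i
    by_cases hDs : D s = C s + 1
    · obtain ⟨D', rfl⟩ := exists_add_single_of_apply_ne_zero (A := D) (i := s) (by omega)
      have hD' : D' ≤ C := le_of_add_le_add_right hDle
      have := hmin.eq_of_le (hU.shift_mem D' i s hlt hD) (by gcongr)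
      rw [add_right_cancel this]
    · exfalso
      apply hCU
      refine hU.mem_of_le hD fun l => ?_
      have hl := hDle l
      by_cases hls : l = s
      · subst hls
        simp only [Finsupp.add_apply, Finsupp.single_eq_same] at hl
        omega
      · simpa [Finsupp.single_eq_of_ne hls] using hl
  have : C + Finsupp.single s 1 ∈
      {A | Minimal (· ∈ U) A} ∩ rightShifts (C + Finsupp.single i 1) := by
    refine ⟨hmin', i, s, by rw [← hs], hle.trans_lt hj, by simp, ?_⟩
    rw [add_tsub_cancel_right]
  rw [hempty] at this
  exact this

theorem expansion_eq (hU : IsBorel U) (hA : IsRemovable U A) :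
    expansion (monomialIdeal U : Ideal (MvPolynomial (Fin (m + 1)) K)) A =
      monomialIdeal (U \ lastRay A) := by
  unfold expansion
  rw [hU.minGens_eq]
  have hR := hU.diff_lastRay hA
  refine hR.monomialIdeal_eq fun B => ⟨?_, fun hB => ?_⟩
  · rintro ⟨G, ⟨hG, hGA⟩ | ⟨i, -, hi, rfl⟩, hGB⟩
    · refine hR.mem_of_le ⟨hG.prop, ?_⟩ hGB
      rintro ⟨t, rfl⟩
      exact hGA (hG.eq_of_le hA.1.prop (self_le_add_right _ _)).symm
    · exact hR.mem_of_le ⟨hU.add_mem _ _ hA.1.prop, add_single_notMem_lastRay hi⟩ hGB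
  · obtain ⟨G, hGB, hG⟩ := exists_minimal_le hB.1
    by_cases hGA : G = A
    · subst hGA
      obtain ⟨i, hi, hle⟩ := exists_lt_last_of_notMem_lastRay hGB hB.2
      by_cases hmax : ∀ k ∈ G.support, k ≤ i
      · exact ⟨_, Or.inr ⟨i, hmax, hi, rfl⟩, hle⟩
      · push Not at hmax
        obtain ⟨k, hk, hik⟩ := hmax
        obtain ⟨C, rfl⟩ := exists_add_single_of_apply_ne_zero (Finsupp.mem_support_iff.1 hk)
        obtain ⟨D, hDC, hD⟩ := exists_minimal_le (hU.shift_mem C i k hik hG.prop)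
        refine ⟨D, Or.inl ⟨hD, ?_⟩, hDC.trans (le_trans ?_ hle)⟩
        · rintro rfl
          have := hDC k
          simp [Finsupp.single_eq_of_ne hik.ne'] at this
        · gcongr
          exact self_le_add_right _ _
    · exact ⟨G, Or.inl ⟨hG, hGA⟩, hGB⟩

theorem isRemovable_univ_zero : IsRemovable (Set.univ : Set (Fin (m + 1) →₀ ℕ)) 0 :=
  ⟨⟨trivial, fun _ _ _ => zero_le⟩, fun C i j _ _ h => by
    simpa using DFunLike.congr_fun h i⟩

theorem span_X_eq :
    (Ideal.span {f | ∃ i : Fin (m + 1), i < Fin.last m ∧ f = X i} :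
      Ideal (MvPolynomial (Fin (m + 1)) K)) = monomialIdeal (Set.univ \ lastRay 0) := by
  have hR := (isBorel_univ (m := m)).diff_lastRay isRemovable_univ_zero
  have : {f : MvPolynomial (Fin (m + 1)) K | ∃ i : Fin (m + 1), i < Fin.last m ∧ f = X i} =
      (fun A => monomial A (1 : K)) '' {A | ∃ i, i < Fin.last m ∧ A = Finsupp.single i 1} := by
    ext f
    constructor
    · rintro ⟨i, hi, rfl⟩
      exact ⟨_, ⟨i, hi, rfl⟩, rfl⟩
    · rintro ⟨_, ⟨i, hi, rfl⟩, rfl⟩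
      exact ⟨i, hi, rfl⟩
  rw [this]
  refine hR.monomialIdeal_eq fun B => ⟨?_, fun hB => ?_⟩
  · rintro ⟨_, ⟨i, hi, rfl⟩, hle⟩
    have := add_single_notMem_lastRay (A := (0 : Fin (m + 1) →₀ ℕ)) hi
    rw [zero_add] at this
    exact hR.mem_of_le ⟨trivial, this⟩ hle
  · obtain ⟨i, hi, hle⟩ := exists_lt_last_of_notMem_lastRay (zero_le) hB.2
    exact ⟨_, ⟨i, hi, rfl⟩, by simpa using hle⟩

/-- The expansions of the ideal of a Borel set `U` are the ideals that arise from removing a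
removable monomial from `U`. -/
theorem isExpansion_iff (hU : IsBorel U) {J : Ideal (MvPolynomial (Fin (m + 1)) K)} :
    IsExpansion (monomialIdeal U) J ↔
      ∃ A, IsRemovable U A ∧ J = monomialIdeal (U \ lastRay A) := by
  constructor
  · rintro (⟨A, hA, rfl⟩ | ⟨htop, rfl⟩)
    · exact ⟨A, hA.isRemovable hU, expansion_eq hU (hA.isRemovable hU)⟩
    · obtain rfl := monomialIdeal_injOn hU isBorel_univ (htop.trans monomialIdeal_univ.symm)
      exact ⟨0, isRemovable_univ_zero, span_X_eq⟩
  · rintro ⟨A, hA, rfl⟩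
    by_cases hA0 : A = 0
    · subst hA0
      have hUu : U = Set.univ :=
        Set.eq_univ_of_forall fun B => hU.mem_of_le hA.1.prop (zero_le)
      subst hUu
      exact Or.inr ⟨monomialIdeal_univ, span_X_eq.symm⟩
    · exact Or.inl ⟨A, hA.isExpandable hU hA0, (expansion_eq hU hA).symm⟩

end MonomialIdeals

/-! ### Sequences of expansions -/

section Expansions

variable {K : Type*} [Field K] {m : ℕ} {U V W : Set (Fin (m + 1) →₀ ℕ)}

theorem reachedByExpansions_zero {I J : Ideal (MvPolynomial (Fin (m + 1)) K)} :
    ReachedByExpansions 0 I J ↔ I = J :=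
  ⟨fun ⟨_, h0, hN, _⟩ => h0.symm.trans hN, fun h => ⟨fun _ => I, rfl, h, by simp⟩⟩

theorem reachedByExpansions_succ {N : ℕ} {I J : Ideal (MvPolynomial (Fin (m + 1)) K)} :
    ReachedByExpansions (N + 1) I J ↔ ∃ I', IsExpansion I I' ∧ ReachedByExpansions N I' J := by
  constructor
  · rintro ⟨c, rfl, rfl, h⟩
    exact ⟨c 1, h 0 (Nat.succ_pos N), fun i => c (i + 1), rfl, rfl,
      fun i hi => h (i + 1) (Nat.succ_lt_succ hi)⟩
  · rintro ⟨I', hI', c, rfl, rfl, h⟩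
    refine ⟨fun i => i.casesOn I c, rfl, rfl, fun i hi => ?_⟩
    cases i with
    | zero => exact hI'
    | succ i => exact h i (Nat.lt_of_succ_lt_succ hi)

/-- Every expansion raises the Hilbert function by one in all large degrees, so the number of
expansions between two ideals is determined by their Hilbert functions. -/
theorem ReachedByExpansions.eventually_complCount {N : ℕ} (hV : IsBorel V) (hW : IsBorel W)
    (h : ReachedByExpansions N
      (monomialIdeal V : Ideal (MvPolynomial (Fin (m + 1)) K)) (monomialIdeal W)) :
    ∃ k₀, ∀ k, k₀ ≤ k → complCount W k = complCount V k + N := by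
  induction N generalizing V with
  | zero =>
    rw [monomialIdeal_injOn hV hW (reachedByExpansions_zero.1 h)]
    exact ⟨0, fun _ _ => rfl⟩
  | succ N ih =>
    obtain ⟨I', hI', h⟩ := reachedByExpansions_succ.1 h
    obtain ⟨A, hA, rfl⟩ := (isExpansion_iff hV).1 hI'
    obtain ⟨k₀, hk₀⟩ := ih (hV.diff_lastRay hA) h
    refine ⟨max k₀ A.degree, fun k hk => ?_⟩
    rw [hk₀ k (le_of_max_le_left hk), complCount_diff_lastRay hV hA.1.prop,
      if_pos (le_of_max_le_right hk)]
    omega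

/-- The list `e_0, e_1, …` of natural numbers satisfies `e_s ≤ g + s` for all `s`. -/
def GrowsByOne : ℕ → List ℕ → Prop
  | _, [] => True
  | g, e :: L => e ≤ g ∧ GrowsByOne (g + 1) L

/-- A Borel set `W` whose complement in the Borel set `V` is finite up to the last variable arises
from `V` by expansions; `L` is the list of the degrees of the expanded monomials. As an expansion
raises the largest degree of a generator by at most one, these degrees grow by at most one at each
step. -/
theorem exists_expansions (hV : IsBorel V) (hW : IsBorel W) (hWV : W ⊆ V)
    (hfin : {A | A ∈ V ∧ A ∉ W ∧ A (Fin.last m) = 0}.Finite) :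
    ∃ L : List ℕ,
      ReachedByExpansions L.length
        (monomialIdeal V : Ideal (MvPolynomial (Fin (m + 1)) K)) (monomialIdeal W) ∧
      (∀ k, complCount W k = complCount V k + (L.map fun e => if e ≤ k then 1 else 0).sum) ∧
      ∀ g, GeneratedInDegreeLE V g →
        GrowsByOne g L ∧ GeneratedInDegreeLE W (g + L.length) := by
  induction hN : {A | A ∈ V ∧ A ∉ W ∧ A (Fin.last m) = 0}.ncard using Nat.strong_induction_on
    generalizing V with
  | _ N ih =>
    by_cases hVW : V = W
    · subst hVW
      exact ⟨[], reachedByExpansions_zero.2 rfl, fun k => by simp, fun g hg => ⟨trivial, by simpa⟩⟩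
    · obtain ⟨A, hAW, hA⟩ := exists_isRemovable hW hWV hVW
      have hV' := hV.diff_lastRay hA
      have hWV' : W ⊆ V \ lastRay A := by
        refine fun B hB => ⟨hWV hB, ?_⟩
        rintro ⟨t, rfl⟩
        exact hAW (hW.cancel_single_last t hB)
      have hss : {B | B ∈ V \ lastRay A ∧ B ∉ W ∧ B (Fin.last m) = 0} ⊂
          {B | B ∈ V ∧ B ∉ W ∧ B (Fin.last m) = 0} := by
        refine ⟨fun B hB => ⟨hB.1.1, hB.2⟩, fun hsub => ?_⟩
        exact (hsub (a := A) ⟨hA.1.prop, hAW, hV.apply_last_of_minimal hA.1⟩).1.2 ⟨0, by simp⟩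
      obtain ⟨L, hreach, hcount, hgen⟩ := ih _ (hN ▸ Set.ncard_lt_ncard hss hfin) hV' hWV'
        (hfin.subset hss.1) rfl
      refine ⟨A.degree :: L, reachedByExpansions_succ.2
        ⟨_, (isExpansion_iff hV).2 ⟨A, hA, rfl⟩, hreach⟩, fun k => ?_, fun g hg => ?_⟩
      · rw [hcount, complCount_diff_lastRay hV hA.1.prop, List.map_cons, List.sum_cons, add_assoc]
      · obtain ⟨h1, h2⟩ := hgen (g + 1) (hg.diff_lastRay hV hA.1)
        refine ⟨⟨hg.degree_le hA.1, h1⟩, ?_⟩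
        rwa [List.length_cons, add_comm L.length, ← add_assoc]

theorem exists_generatedInDegreeLE (U : Set (Fin (m + 1) →₀ ℕ)) :
    ∃ g, GeneratedInDegreeLE U g := by
  have hfin : {A | Minimal (· ∈ U) A}.Finite :=
    (setOfPred_minimal_antichain (· ∈ U)).finite_of_wellQuasiOrdered wellQuasiOrdered_le
  obtain ⟨g, hg⟩ := (hfin.image Finsupp.degree).bddAbove
  refine ⟨g, fun B hB => ?_⟩
  obtain ⟨A, hAB, hA⟩ := exists_minimal_le hB
  exact ⟨A, hA.prop, hAB, hg ⟨A, hA, rfl⟩⟩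

end Expansions

/-! ### The ideals `I^{(j)}` and their extensions -/

section Shadow

variable {K : Type*} [Field K] {n m k l r : ℕ} {U : Set (Fin (n + 1) →₀ ℕ)}

/-- The exponents in `m + 1` variables that lie above some element of `U` as far as the first `r`
variables are concerned. For a Borel set `U`, this is the exponent set of the ideal generated
in `K[x_0, …, x_m]` by the monomials in `U` after substituting `1` for `x_r, x_{r+1}, …`; here
`r ≤ m` and `r ≤ n` are understood. -/
def shadow (U : Set (Fin (n + 1) →₀ ℕ)) (m r : ℕ) : Set (Fin (m + 1) →₀ ℕ) :=
  {B | ∃ A ∈ U, ∀ (i : Fin (n + 1)) (l : Fin (m + 1)), (i : ℕ) = l → (i : ℕ) < r → A i ≤ B l}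

theorem shadow_anti {r' : ℕ} (h : r' ≤ r) : shadow U m r ⊆ shadow U m r' :=
  fun _ ⟨A, hA, hle⟩ => ⟨A, hA, fun i l hil hi => hle i l hil (hi.trans_le h)⟩

theorem IsBorel.shadow (hU : IsBorel U) (hr : r ≤ m) (hm : m ≤ n) : IsBorel (shadow U m r) where
  add_mem := fun B C ⟨A, hA, hle⟩ =>
    ⟨A, hA, fun i l hil hi => (hle i l hil hi).trans (Nat.le_add_right _ _)⟩
  cancel_last := fun B ⟨A, hA, hle⟩ => by
    refine ⟨A, hA, fun i l hil hi => ?_⟩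
    have hl : l ≠ Fin.last m := by
      rintro rfl
      rw [Fin.val_last] at hil
      omega
    simpa [Finsupp.single_eq_of_ne hl] using hle i l hil hi
  shift_mem := fun B i j hij ⟨A, hA, hle⟩ => by
    have hj : (j : ℕ) < n + 1 := j.2.trans_le (Nat.succ_le_succ hm)
    have hlt : (i : ℕ) < j := hij
    by_cases hcase : (j : ℕ) < r ∧ B j < A ⟨j, hj⟩
    · obtain ⟨C, rfl⟩ := exists_add_single_of_apply_ne_zero (A := A) (i := ⟨j, hj⟩) (by omega)
      refine ⟨_, hU.shift_mem C ⟨i, hlt.trans hj⟩ ⟨j, hj⟩ hij hA, fun a b hab ha => ?_⟩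
      have hC : C a ≤ B b := by
        have := hle a b hab ha
        by_cases hb : b = j
        · subst hb
          obtain rfl : a = ⟨b, hj⟩ := Fin.ext hab
          simpa using this
        · have ha' : a ≠ ⟨j, hj⟩ := fun h => hb (Fin.ext (by rw [← hab, h]))
          simpa [Finsupp.single_eq_of_ne hb, Finsupp.single_eq_of_ne ha'] using this
      have hiff : a = ⟨i, hlt.trans hj⟩ ↔ b = i := by
        rw [Fin.ext_iff, Fin.ext_iff, hab]
      simp only [Finsupp.add_apply, Finsupp.single_apply]
      simp only [eq_comm (b := a), eq_comm (b := b), hiff]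
      exact Nat.add_le_add_right hC _
    · refine ⟨A, hA, fun a b hab ha => ?_⟩
      have hB : A a ≤ B b := by
        by_cases hb : b = j
        · subst hb
          obtain rfl : a = ⟨b, hj⟩ := Fin.ext hab
          by_contra! hcon
          exact hcase ⟨ha, hcon⟩
        · simpa [Finsupp.single_eq_of_ne hb] using hle a b hab ha
      exact hB.trans (Nat.le_add_right _ _)

theorem IsBorel.shadow_self (hU : IsBorel U) : StronglyStableIdeals.shadow U n n = U := by
  refine Set.Subset.antisymm (fun B ⟨A, hA, hle⟩ => ?_)
    fun B hB => ⟨B, hB, fun i l hil _ => le_of_eq (congrArg B (Fin.ext hil))⟩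
  have : A ≤ B + Finsupp.single (Fin.last n) (A (Fin.last n)) := by
    intro i
    by_cases hi : i = Fin.last n
    · subst hi
      simp
    · have := hle i i rfl (Fin.lt_last_iff_ne_last.2 hi)
      simpa [Finsupp.single_eq_of_ne hi] using this
  exact hU.cancel_single_last _ (hU.mem_of_le hA this)

/-- The exponent of the monomial `x^A` after substituting `1` for `x_r, x_{r+1}, …`. -/
def truncateExponent (m r : ℕ) (h : r ≤ m) (A : Fin (n + 1) →₀ ℕ) : Fin (m + 1) →₀ ℕ :=
  ∑ i : Fin (n + 1), if hi : (i : ℕ) < r then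
    Finsupp.single (⟨i, Nat.lt_succ_of_lt (hi.trans_le h)⟩ : Fin (m + 1)) (A i) else 0

theorem truncateExponent_le_iff (h : r ≤ m) {A : Fin (n + 1) →₀ ℕ} {B : Fin (m + 1) →₀ ℕ} :
    truncateExponent m r h A ≤ B ↔
      ∀ (i : Fin (n + 1)) (l : Fin (m + 1)), (i : ℕ) = l → (i : ℕ) < r → A i ≤ B l := by
  have hval : ∀ l : Fin (m + 1), truncateExponent m r h A l =
      ∑ i : Fin (n + 1), if (i : ℕ) = l ∧ (i : ℕ) < r then A i else 0 := by
    intro l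
    rw [truncateExponent, Finsupp.finsetSum_apply]
    refine Finset.sum_congr rfl fun i _ => ?_
    by_cases hi : (i : ℕ) < r
    · simp [hi, Finsupp.single_apply, Fin.ext_iff]
    · simp [hi]
  constructor
  · intro hle i l hil hi
    refine le_trans ?_ (hle l)
    rw [hval]
    refine le_trans (le_of_eq ?_) (Finset.single_le_sum (fun _ _ => Nat.zero_le _)
      (Finset.mem_univ i))
    rw [if_pos ⟨hil, hi⟩]
  · intro hle l
    rw [hval]
    by_cases hl : ∃ i : Fin (n + 1), (i : ℕ) = l
    · obtain ⟨i, hi⟩ := hl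
      rw [Finset.sum_eq_single i]
      · split_ifs with h1
        · exact hle i l h1.1 h1.2
        · exact Nat.zero_le _
      · intro b _ hb
        rw [if_neg]
        exact fun h1 => hb (Fin.ext (h1.1.trans hi.symm))
      · simp
    · rw [Finset.sum_eq_zero]
      · exact Nat.zero_le _
      · intro i _
        rw [if_neg]
        exact fun h1 => hl ⟨i, h1.1⟩

theorem setOne_monomial (j : ℕ) (A : Fin (n + 1) →₀ ℕ) :
    setOne j (monomial A (1 : K)) =
      monomial (truncateExponent (n - j) (n - j) le_rfl A) (1 : K) := by
  rw [setOne, aeval_monomial, map_one, one_mul, Finsupp.prod_fintype _ _ (fun _ => pow_zero _),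
    truncateExponent, monomial_sum_one]
  refine Finset.prod_congr rfl fun i _ => ?_
  by_cases hi : (i : ℕ) < n - j
  · rw [dif_pos hi, dif_pos hi, X_pow_eq_monomial]
  · rw [dif_neg hi, dif_neg hi, one_pow]
    rfl

theorem idealAt_eq (hU : IsBorel U) {j : ℕ} (hj : j ≤ n) :
    idealAt (monomialIdeal U : Ideal (MvPolynomial (Fin (n + 1)) K)) j =
      monomialIdeal (shadow U (n - j) (n - j)) := by
  rw [idealAt, if_pos hj, hU.minGens_eq]
  simp only [setOne_monomial]
  have := (hU.shadow (le_refl (n - j)) (Nat.sub_le n j)).monomialIdeal_eq (K := K)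
    (S := truncateExponent (n - j) (n - j) le_rfl '' {A | Minimal (· ∈ U) A}) fun B => ?_
  · rw [← this, monomialIdeal, Set.image_image]
  · constructor
    · rintro ⟨_, ⟨A, hA, rfl⟩, hle⟩
      exact ⟨A, hA.prop, (truncateExponent_le_iff le_rfl).1 hle⟩
    · rintro ⟨A, hA, hle⟩
      obtain ⟨A', hA'A, hA'⟩ := exists_minimal_le hA
      exact ⟨_, ⟨A', hA', rfl⟩, (truncateExponent_le_iff le_rfl).2
        fun i l hil hi => (hA'A i).trans (hle i l hil hi)⟩

theorem map_rename_monomialIdeal_shadow (hkl : k + 1 ≤ l + 1) (hr : r ≤ k) :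
    (monomialIdeal (shadow U k r)).map (rename (Fin.castLE hkl) :
      MvPolynomial (Fin (k + 1)) K →ₐ[K] MvPolynomial (Fin (l + 1)) K) =
      monomialIdeal (shadow U l r) := by
  have hinj : Function.Injective (Fin.castLE hkl) := Fin.castLE_injective hkl
  have h1 : (monomialIdeal (shadow U k r)).map (rename (Fin.castLE hkl) :
      MvPolynomial (Fin (k + 1)) K →ₐ[K] MvPolynomial (Fin (l + 1)) K) =
      monomialIdeal (Finsupp.mapDomain (Fin.castLE hkl) '' shadow U k r) := by
    rw [monomialIdeal, Ideal.map_span, monomialIdeal, Set.image_image, Set.image_image]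
    simp only [rename_monomial]
  rw [h1]
  refine monomialIdeal_congr fun B => ⟨?_, ?_⟩
  · rintro ⟨_, ⟨D, ⟨A, hA, hle⟩, rfl⟩, hDB⟩
    refine ⟨B, ⟨A, hA, fun i b hib hi => ?_⟩, le_rfl⟩
    have hik : (i : ℕ) < k + 1 := by omega
    obtain rfl : b = Fin.castLE hkl ⟨i, hik⟩ := Fin.ext hib.symm
    refine le_trans (hle i ⟨i, hik⟩ rfl hi) ?_
    have := hDB (Fin.castLE hkl ⟨i, hik⟩)
    rwa [Finsupp.mapDomain_apply hinj] at this
  · rintro ⟨B', ⟨A, hA, hle⟩, hB'⟩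
    refine ⟨_, ⟨B.comapDomain (Fin.castLE hkl) hinj.injOn, ⟨A, hA, fun i b hib hi => ?_⟩, rfl⟩, ?_⟩
    · rw [Finsupp.comapDomain_apply]
      exact (hle i _ hib hi).trans (hB' _)
    · intro b
      by_cases hb : b ∈ Set.range (Fin.castLE hkl)
      · obtain ⟨c, rfl⟩ := hb
        rw [Finsupp.mapDomain_apply hinj, Finsupp.comapDomain_apply]
      · rw [Finsupp.mapDomain_of_notMem_range _ _ hb]
        exact Nat.zero_le _

theorem extendedIdealAt_eq (hU : IsBorel U) {j : ℕ} (hj : j < n) :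
    extendedIdealAt (monomialIdeal U : Ideal (MvPolynomial (Fin (n + 1)) K)) j =
      monomialIdeal (shadow U (n - j) (n - (j + 1))) := by
  rw [extendedIdealAt, idealAt_eq hU hj]
  exact map_rename_monomialIdeal_shadow _ le_rfl

theorem extendedIdealAt_self (I : Ideal (MvPolynomial (Fin (n + 1)) K)) :
    extendedIdealAt I n = ⊤ := by
  rw [extendedIdealAt, idealAt, if_neg (by omega), Ideal.map_top]

end Shadow

/-! ### Adding a variable -/

section AddVariable

variable {m : ℕ} {V : Set (Fin (m + 2) →₀ ℕ)} {W : Set (Fin (m + 1) →₀ ℕ)}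

theorem complCount_zero {U : Set (Fin (m + 1) →₀ ℕ)} [Decidable ((0 : Fin (m + 1) →₀ ℕ) ∈ U)] :
    complCount U 0 = if (0 : Fin (m + 1) →₀ ℕ) ∈ U then 0 else 1 := by
  unfold complCount
  simp only [Finsupp.degree_eq_zero_iff]
  split_ifs with h
  · rw [Set.ncard_eq_zero ((Set.finite_singleton 0).subset fun B hB => hB.1),
      Set.eq_empty_iff_forall_notMem]
    rintro B ⟨rfl, hB⟩
    exact hB h
  · have : {B : Fin (m + 1) →₀ ℕ | B = 0 ∧ B ∉ U} = {0} := by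
      ext B
      exact ⟨fun hB => hB.1, fun hB => by rw [Set.mem_singleton_iff.1 hB]; exact ⟨rfl, h⟩⟩
    rw [this, Set.ncard_singleton]

theorem complCount_extend_zero (hVW : ∀ D, Finsupp.mapDomain Fin.castSucc D ∈ V ↔ D ∈ W) :
    complCount V 0 = complCount W 0 := by
  classical
  have := hVW 0
  rw [Finsupp.mapDomain_zero] at this
  rw [complCount_zero, complCount_zero]
  simp only [this]

/-- The monomials of degree `t + 1` outside the extension are either divisible by the last
variable or free of it. -/
theorem complCount_extend_succ (hV : IsBorel V)
    (hVW : ∀ D, Finsupp.mapDomain Fin.castSucc D ∈ V ↔ D ∈ W) (t : ℕ) :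
    complCount V (t + 1) = complCount V t + complCount W (t + 1) := by
  have hinj : Function.Injective (Fin.castSucc : Fin (m + 1) → Fin (m + 2)) :=
    Fin.castSucc_injective _
  have hset : {B : Fin (m + 2) →₀ ℕ | B.degree = t + 1 ∧ B ∉ V} =
      (fun B => B + Finsupp.single (Fin.last (m + 1)) 1) '' {B | B.degree = t ∧ B ∉ V} ∪
        Finsupp.mapDomain Fin.castSucc '' {D | D.degree = t + 1 ∧ D ∉ W} := by
    ext B
    constructor
    · rintro ⟨hdeg, hB⟩
      by_cases hlast : B (Fin.last (m + 1)) = 0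
      · right
        have hB' : Finsupp.mapDomain Fin.castSucc (B.comapDomain Fin.castSucc hinj.injOn) = B := by
          refine Finsupp.mapDomain_comapDomain _ hinj _ fun i hi => ?_
          have hi' : i ≠ Fin.last (m + 1) := by
            rintro rfl
            exact Finsupp.mem_support_iff.1 hi hlast
          exact ⟨i.castPred hi', Fin.castSucc_castPred i hi'⟩
        refine ⟨_, ⟨?_, ?_⟩, hB'⟩
        · rw [← hdeg, ← hB', Finsupp.degree_mapDomain, hB']
        · rw [← hVW, hB']
          exact hB
      · left
        obtain ⟨C, rfl⟩ := exists_add_single_of_apply_ne_zero hlast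
        refine ⟨C, ⟨?_, fun hC => hB (hV.add_mem _ _ hC)⟩, rfl⟩
        rw [map_add, Finsupp.degree_single] at hdeg
        exact Nat.succ_injective hdeg
    · rintro (⟨C, ⟨hdeg, hC⟩, rfl⟩ | ⟨D, ⟨hdeg, hD⟩, rfl⟩)
      · refine ⟨?_, fun h => hC (hV.cancel_last _ h)⟩
        rw [map_add, Finsupp.degree_single, hdeg]
      · exact ⟨by rw [Finsupp.degree_mapDomain, hdeg], by rwa [hVW]⟩
  unfold complCount
  rw [hset, Set.ncard_union_eq ?_ ((finite_complCount_set V t).image _)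
    ((finite_complCount_set W (t + 1)).image _),
    Set.ncard_image_of_injective _ (add_left_injective _),
    Set.ncard_image_of_injective _ (Finsupp.mapDomain_injective hinj)]
  rw [Set.disjoint_left]
  rintro _ ⟨C, -, rfl⟩ ⟨D, -, hD⟩
  have h1 := DFunLike.congr_fun hD (Fin.last (m + 1))
  rw [Finsupp.mapDomain_of_notMem_range] at h1
  · simp at h1
  · rintro ⟨i, hi⟩
    exact (Fin.castSucc_lt_last i).ne hi

theorem mapDomain_castSucc_mem_shadow_iff {n r : ℕ} {U : Set (Fin (n + 1) →₀ ℕ)} (hr : r ≤ m)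
    (D : Fin (m + 1) →₀ ℕ) :
    Finsupp.mapDomain Fin.castSucc D ∈ shadow U (m + 1) r ↔ D ∈ shadow U m r := by
  have hinj : Function.Injective (Fin.castSucc : Fin (m + 1) → Fin (m + 2)) :=
    Fin.castSucc_injective _
  constructor
  · rintro ⟨A, hA, hle⟩
    refine ⟨A, hA, fun i l hil hi => ?_⟩
    have := hle i l.castSucc hil hi
    rwa [Finsupp.mapDomain_apply hinj] at this
  · rintro ⟨A, hA, hle⟩
    refine ⟨A, hA, fun i l hil hi => ?_⟩
    have hl : (i : ℕ) < m + 1 := by omega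
    obtain rfl : l = Fin.castSucc ⟨i, hl⟩ := Fin.ext hil.symm
    rw [Finsupp.mapDomain_apply hinj]
    exact hle i _ rfl hi

/-- Extending by one variable preserves degrees of generators. -/
theorem GeneratedInDegreeLE.extend {g : ℕ} (hV : IsBorel V)
    (hVW : ∀ D, Finsupp.mapDomain Fin.castSucc D ∈ V ↔ D ∈ W) (hW : GeneratedInDegreeLE W g) :
    GeneratedInDegreeLE V g := by
  have hinj : Function.Injective (Fin.castSucc : Fin (m + 1) → Fin (m + 2)) :=
    Fin.castSucc_injective _
  intro B hB
  have hB' : Finsupp.mapDomain Fin.castSucc (B.comapDomain Fin.castSucc hinj.injOn) =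
      B.erase (Fin.last (m + 1)) := by
    ext i
    by_cases hi : i = Fin.last (m + 1)
    · subst hi
      rw [Finsupp.mapDomain_of_notMem_range, Finsupp.erase_same]
      rintro ⟨i, hi⟩
      exact (Fin.castSucc_lt_last i).ne hi
    · obtain ⟨c, rfl⟩ := Fin.exists_castSucc_eq.2 hi
      rw [Finsupp.mapDomain_apply hinj, Finsupp.comapDomain_apply, Finsupp.erase_ne hi]
  have hmem := hV.erase_last_mem hB
  rw [← hB', hVW] at hmem
  obtain ⟨D, hD, hDle, hDg⟩ := hW _ hmem
  refine ⟨_, (hVW D).2 hD, fun i => ?_, by rwa [Finsupp.degree_mapDomain]⟩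
  by_cases hi : i ∈ Set.range (Fin.castSucc : Fin (m + 1) → Fin (m + 2))
  · obtain ⟨c, rfl⟩ := hi
    rw [Finsupp.mapDomain_apply hinj]
    exact hDle c
  · rw [Finsupp.mapDomain_of_notMem_range _ _ hi]
    exact Nat.zero_le _

end AddVariable

/-! ### Finiteness of the difference -/

section Finiteness

variable {m : ℕ} {V W : Set (Fin (m + 1) →₀ ℕ)}

theorem IsBorel.add_mem_of_degree_eq (hW : IsBorel W) {l : Fin (m + 1)} (T : ℕ)
    {A C : Fin (m + 1) →₀ ℕ} (hA : A + Finsupp.single l T ∈ W) (hC : ∀ i, C i ≠ 0 → i ≤ l)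
    (hT : C.degree = T) : A + C ∈ W := by
  induction T generalizing A C with
  | zero =>
    rw [(Finsupp.degree_eq_zero_iff C).1 hT]
    simpa using hA
  | succ T ih =>
    have hne : C ≠ 0 := by
      rintro rfl
      simp at hT
    obtain ⟨i, hi⟩ := DFunLike.ne_iff.1 hne
    obtain ⟨D, rfl⟩ := exists_add_single_of_apply_ne_zero hi
    rw [← add_assoc, add_right_comm]
    refine ih (A := A + Finsupp.single i 1) ?_ (fun b hb => hC b ?_) ?_
    · rw [add_right_comm]
      refine hW.shift_mem_le (hC i hi) ?_
      rwa [add_assoc, ← Finsupp.single_add]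
    · rw [Finsupp.add_apply]
      omega
    · rw [map_add, Finsupp.degree_single] at hT
      exact Nat.succ_injective hT

/-- If every monomial in `V` is moved into `W` by a power of the penultimate variable, then up
to the last variable only finitely many monomials of `V` are outside `W`. -/
theorem finite_diff (hW : IsBorel W) {l : Fin (m + 1)}
    (hl : ∀ i, i ≠ Fin.last m → i ≤ l) (h : ∀ B ∈ V, ∃ t, B + Finsupp.single l t ∈ W) :
    {A | A ∈ V ∧ A ∉ W ∧ A (Fin.last m) = 0}.Finite := by
  obtain ⟨g, hg⟩ := exists_generatedInDegreeLE V
  choose! t ht using h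
  obtain ⟨T, hT⟩ := ((Finsupp.finite_of_degree_le (σ := Fin (m + 1)) g).image t).bddAbove
  refine (Finsupp.finite_of_degree_le (g + T)).subset ?_
  rintro B ⟨hBV, hBW, hB⟩
  obtain ⟨A, hA, hAB, hAg⟩ := hg B hBV
  obtain ⟨C, rfl⟩ := exists_add_of_le hAB
  by_contra! hdeg
  rw [Set.mem_ofPred_eq, not_le, map_add] at hdeg
  obtain ⟨C', hC'C, hC'⟩ := Finsupp.exists_le_degree_eq C T (by omega)
  have hAT : A + Finsupp.single l T ∈ W := by
    refine hW.mem_of_le (ht A hA) ?_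
    gcongr
    exact hT ⟨A, hAg, rfl⟩
  refine hBW (hW.mem_of_le (hW.add_mem_of_degree_eq T hAT (fun i hi => hl i ?_) hC')
    (by gcongr))
  rintro rfl
  rw [Finsupp.add_apply] at hB
  have := hC'C (Fin.last m)
  omega

end Finiteness

/-! ### Binomial polynomials and backward differences -/

theorem binomPoly_zero (c : ℤ) : binomPoly c 0 = 1 := by
  simp [binomPoly]

theorem binomPoly_comp (c : ℤ) (m : ℕ) :
    (binomPoly c m).comp (Polynomial.X - 1) = binomPoly (c - 1) m := by
  simp only [binomPoly, Polynomial.mul_comp, Polynomial.C_comp, Polynomial.prod_comp,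
    Polynomial.add_comp, Polynomial.X_comp]
  congr 1
  refine Finset.prod_congr rfl fun k _ => ?_
  push_cast
  simp only [map_sub, map_one]
  ring

/-- Pascal's rule. -/
theorem binomPoly_succ_sub (c : ℤ) (m : ℕ) :
    binomPoly (c + 1) (m + 1) - binomPoly c (m + 1) = binomPoly c m := by
  simp only [binomPoly]
  rw [Finset.prod_range_succ', Finset.prod_range_succ, ← mul_sub]
  have h1 : ∀ k ∈ Finset.range m,
      (Polynomial.X + Polynomial.C (((c + 1 : ℤ) : ℚ) - ((k + 1 : ℕ) : ℚ)) : Polynomial ℚ) =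
        Polynomial.X + Polynomial.C ((c : ℚ) - (k : ℚ)) := by
    intro k _
    congr 2
    push_cast
    ring
  rw [Finset.prod_congr rfl h1]
  have h2 : (Polynomial.X + Polynomial.C (((c + 1 : ℤ) : ℚ) - ((0 : ℕ) : ℚ)) : Polynomial ℚ) =
      (Polynomial.X + Polynomial.C ((c : ℚ) - (m : ℚ))) + Polynomial.C ((m : ℚ) + 1) := by
    rw [add_assoc, ← Polynomial.C_add]
    congr 2
    push_cast
    ring
  rw [h2, mul_add, add_sub_cancel_left, mul_comm (∏ _ ∈ _, _), ← mul_assoc, ← Polynomial.C_mul]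
  congr 2
  have : (m.factorial : ℚ) ≠ 0 := by positivity
  rw [Nat.factorial_succ]
  push_cast
  field_simp

theorem backwardDiff_binomPoly_succ (c : ℤ) (m : ℕ) :
    backwardDiff (binomPoly c (m + 1)) = binomPoly (c - 1) m := by
  rw [backwardDiff, binomPoly_comp, ← binomPoly_succ_sub (c - 1) m, sub_add_cancel]

theorem backwardDiff_one : backwardDiff 1 = 0 := by
  simp [backwardDiff]

/-- The operator `backwardDiff` as a homomorphism of additive groups. -/
def backwardDiffHom : Polynomial ℚ →+ Polynomial ℚ :=
  AddMonoidHom.mk' backwardDiff fun p q => by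
    simp only [backwardDiff, Polynomial.add_comp]
    ring

theorem backwardDiff_sum {ι : Type*} (s : Finset ι) (f : ι → Polynomial ℚ) :
    backwardDiff (∑ i ∈ s, f i) = ∑ i ∈ s, backwardDiff (f i) :=
  map_sum backwardDiffHom f s

theorem backwardDiff_sub (p q : Polynomial ℚ) :
    backwardDiff (p - q) = backwardDiff p - backwardDiff q :=
  map_sub backwardDiffHom p q

theorem eval_binomPoly {c : ℤ} {x : ℚ} {N : ℕ} (h : x + c = N) (m : ℕ) :
    (binomPoly c m).eval x = N.choose m := by
  have : ∏ k ∈ Finset.range m, (x + ((c : ℚ) - k)) = (N.descFactorial m : ℚ) := by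
    rw [← descPochhammer_eval_eq_descFactorial, descPochhammer_eval_eq_prod_range]
    exact Finset.prod_congr rfl fun k _ => by rw [← h]; ring
  simp only [binomPoly, Polynomial.eval_mul, Polynomial.eval_C, Polynomial.eval_prod,
    Polynomial.eval_add, Polynomial.eval_X]
  rw [this, Nat.descFactorial_eq_factorial_mul_choose]
  have : (m.factorial : ℚ) ≠ 0 := by positivity
  push_cast
  field_simp

theorem natDegree_binomPoly_le (c : ℤ) (m : ℕ) : (binomPoly c m).natDegree ≤ m := by
  refine (Polynomial.natDegree_C_mul_le _ _).trans ?_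
  rw [Polynomial.natDegree_prod_of_monic _ _ fun k _ => Polynomial.monic_X_add_C _]
  simp only [Polynomial.natDegree_X_add_C, Finset.sum_const, Finset.card_range, smul_eq_mul,
    mul_one, le_refl]

theorem coeff_binomPoly (c : ℤ) (m : ℕ) :
    (binomPoly c m).coeff m = (m.factorial : ℚ)⁻¹ := by
  have hmonic : (∏ k ∈ Finset.range m,
      (Polynomial.X + Polynomial.C ((c : ℚ) - (k : ℚ)) : Polynomial ℚ)).Monic :=
    Polynomial.monic_prod_of_monic _ _ fun k _ => Polynomial.monic_X_add_C _
  have hdeg : (∏ k ∈ Finset.range m,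
      (Polynomial.X + Polynomial.C ((c : ℚ) - (k : ℚ)) : Polynomial ℚ)).natDegree = m := by
    rw [Polynomial.natDegree_prod_of_monic _ _ fun k _ => Polynomial.monic_X_add_C _]
    simp only [Polynomial.natDegree_X_add_C, Finset.sum_const, Finset.card_range, smul_eq_mul,
      mul_one]
  have h := hmonic.coeff_natDegree
  rw [hdeg] at h
  rw [binomPoly, Polynomial.coeff_C_mul, h, mul_one]

/-! ### Cones -/

/-- The number of monomials of degree `k` in the cone `x^A K[y_0, …, y_i]` with `x^A` of
degree `e`. -/
def coneCount (i e k : ℕ) : ℕ := if e ≤ k then (k - e + i).choose i else 0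

/-- The Hilbert polynomial of a cone over `i + 1` variables with apex in degree `e`. -/
def conePoly (i e : ℕ) : Polynomial ℚ := binomPoly ((i : ℤ) - e) i

theorem coneCount_zero (e k : ℕ) : coneCount 0 e k = if e ≤ k then 1 else 0 := by
  simp [coneCount]

theorem coneCount_succ_zero (i e : ℕ) : coneCount (i + 1) e 0 = coneCount i e 0 := by
  rcases Nat.eq_zero_or_pos e with rfl | he
  · simp [coneCount]
  · simp [coneCount, he.ne']

theorem coneCount_succ_succ (i e k : ℕ) :
    coneCount (i + 1) e (k + 1) = coneCount (i + 1) e k + coneCount i e (k + 1) := by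
  unfold coneCount
  rcases lt_trichotomy e (k + 1) with h | rfl | h
  · rw [if_pos h.le, if_pos (Nat.le_of_lt_succ h), if_pos h.le,
      show k + 1 - e + (i + 1) = (k - e + (i + 1)) + 1 by omega,
      show k + 1 - e + i = k - e + (i + 1) by omega, Nat.choose_succ_succ, add_comm]
  · simp
  · rw [if_neg (by omega), if_neg (by omega), if_neg (by omega)]

theorem eval_conePoly {i e k : ℕ} (h : e ≤ k) :
    (conePoly i e).eval (k : ℚ) = coneCount i e k := by
  rw [coneCount, if_pos h, conePoly]
  refine eval_binomPoly ?_ i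
  push_cast [Nat.cast_sub h]
  ring

theorem conePoly_zero (e : ℕ) : conePoly 0 e = 1 := binomPoly_zero _

theorem backwardDiff_conePoly_succ (i e : ℕ) :
    backwardDiff (conePoly (i + 1) e) = conePoly i e := by
  rw [conePoly, backwardDiff_binomPoly_succ, conePoly]
  congr 1
  push_cast
  ring

theorem conePoly_succ (i e : ℕ) :
    conePoly (i + 1) e = conePoly (i + 1) (e + 1) + conePoly i e := by
  have h := binomPoly_succ_sub ((i : ℤ) - e) i
  rw [sub_eq_iff_eq_add'] at h
  unfold conePoly
  convert h using 2 <;> push_cast <;> ring_nf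

/-! ### Rearranging cones into a Macaulay representation -/

theorem GrowsByOne.mono {g g' : ℕ} (h : g ≤ g') {L : List ℕ} (hL : GrowsByOne g L) :
    GrowsByOne g' L := by
  induction L generalizing g g' with
  | nil => trivial
  | cons e L ih => exact ⟨hL.1.trans h, ih (Nat.succ_le_succ h) hL.2⟩

theorem growsByOne_of_forall_le {g : ℕ} {L : List ℕ} (h : ∀ e ∈ L, e ≤ g) : GrowsByOne g L := by
  induction L generalizing g with
  | nil => trivial
  | cons e L ih =>
    exact ⟨h e List.mem_cons_self, ih fun e' he' => (h e' (List.mem_cons_of_mem _ he')).trans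
      (Nat.le_succ g)⟩

theorem GrowsByOne.append {g : ℕ} {L L' : List ℕ} (hL : GrowsByOne g L)
    (hL' : GrowsByOne (g + L.length) L') : GrowsByOne g (L ++ L') := by
  induction L generalizing g with
  | nil => exact hL'
  | cons e L ih =>
    refine ⟨hL.1, ih hL.2 (hL'.mono ?_)⟩
    rw [List.length_cons]
    omega

/-- Raising the apex of a cone splits off cones with one variable less. -/
theorem exists_conePoly_raise (d : ℕ) {e c : ℕ} (h : e ≤ c) :
    ∃ X : List ℕ, conePoly (d + 1) e = conePoly (d + 1) c + (X.map (conePoly d)).sum ∧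
      ∀ t ∈ X, t ≤ c := by
  induction c, h using Nat.le_induction with
  | base => exact ⟨[], by simp, by simp⟩
  | succ c _ ih =>
    obtain ⟨X, hX, hle⟩ := ih
    refine ⟨c :: X, ?_, ?_⟩
    · rw [hX, conePoly_succ d c, List.map_cons, List.sum_cons, add_assoc]
    · intro t ht
      rcases List.mem_cons.1 ht with rfl | ht
      · exact Nat.le_succ t
      · exact (hle t ht).trans (Nat.le_succ c)

theorem GrowsByOne.exists_raise (d : ℕ) {c : ℕ} {L : List ℕ} (hL : GrowsByOne c L) :
    ∃ X : List ℕ, (L.map (conePoly (d + 1))).sum =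
      ∑ s ∈ Finset.Ico c (c + L.length), conePoly (d + 1) s + (X.map (conePoly d)).sum ∧
      ∀ t ∈ X, t ≤ c + L.length := by
  induction L generalizing c with
  | nil => exact ⟨[], by simp, by simp⟩
  | cons e L ih =>
    obtain ⟨X, hX, hXle⟩ := exists_conePoly_raise d hL.1
    obtain ⟨Y, hY, hYle⟩ := ih hL.2
    have hlen : c + (e :: L).length = c + 1 + L.length := by
      rw [List.length_cons]
      omega
    refine ⟨X ++ Y, ?_, fun t ht => ?_⟩
    · rw [hlen, Finset.sum_eq_sum_Ico_succ_bot (by omega), List.map_cons, List.sum_cons, hX, hY,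
        List.map_append, List.sum_append]
      ring
    · rcases List.mem_append.1 ht with ht | ht
      · exact (hXle t ht).trans (Nat.le_add_right _ _)
      · rw [hlen]
        exact hYle t ht

/-- Let cones be ordered by decreasing dimension, such that no apex degree exceeds the position of
its cone. Raising the apex degrees to the positions, from the largest dimension down, each time
splits off cones of the next smaller dimension which still satisfy the condition; hence it
arrives at a representation in which apex degrees and positions coincide, and in which no
dimension has lost a cone. Here `M j` lists the apex degrees of the cones over `j + 1` variables,
`G j` is the position after the last of these, and the resulting cones over `j + 1` variables occupy
the positions from `b (j + 1)` to `b j`. -/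
theorem exists_rearrangement (d : ℕ) (M : ℕ → List ℕ) (G : ℕ → ℕ)
    (hG : ∀ j ≤ d, G j = G (j + 1) + (M j).length)
    (hM : ∀ j ≤ d, GrowsByOne (G (j + 1)) (M j)) :
    ∃ b : ℕ → ℕ, (∀ j, d < j → b j = G (d + 1)) ∧
      (∀ j ≤ d, b (j + 1) + (M j).length ≤ b j) ∧
      ∑ j ∈ Finset.range (d + 1), ((M j).map (conePoly j)).sum =
        ∑ j ∈ Finset.range (d + 1), ∑ s ∈ Finset.Ico (b (j + 1)) (b j), conePoly j s := by
  induction d generalizing M G with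
  | zero =>
    refine ⟨fun j => if j = 0 then G 0 else G 1, fun j hj => if_neg hj.ne', fun j hj => ?_, ?_⟩
    · obtain rfl := Nat.le_zero.1 hj
      simpa using (hG 0 le_rfl).ge
    · simp [conePoly_zero, hG 0 le_rfl, funext conePoly_zero]
  | succ d ih =>
    obtain ⟨X, hX, hXle⟩ := (hM (d + 1) le_rfl).exists_raise d
    have hGd := hG (d + 1) le_rfl
    rw [← hGd] at hX hXle
    let M' : ℕ → List ℕ := Function.update M d (X ++ M d)
    let G' : ℕ → ℕ := fun j => if j ≤ d then G j + X.length else G j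
    have hG' : ∀ j ≤ d, G' j = G' (j + 1) + (M' j).length := by
      intro j hj
      simp only [G', M']
      rw [if_pos hj]
      have := hG j (by omega)
      rcases hj.eq_or_lt with rfl | hj'
      · rw [if_neg (by omega), Function.update_self, List.length_append]
        omega
      · rw [if_pos (by omega), Function.update_of_ne hj'.ne]
        omega
    have hM' : ∀ j ≤ d, GrowsByOne (G' (j + 1)) (M' j) := by
      intro j hj
      simp only [G', M']
      rcases hj.eq_or_lt with rfl | hj'
      · rw [if_neg (by omega), Function.update_self]
        exact (growsByOne_of_forall_le hXle).append
          ((hM j (by omega)).mono (Nat.le_add_right _ _))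
      · rw [if_pos (by omega), Function.update_of_ne hj'.ne]
        exact (hM j (by omega)).mono (Nat.le_add_right _ _)
    obtain ⟨b, hb, hbM, hsum⟩ := ih M' G' hG' hM'
    simp only [G', M'] at hb hbM hsum
    have hb1 : b (d + 1) = G (d + 1) := by
      rw [hb _ (Nat.lt_succ_self d), if_neg (by omega)]
    refine ⟨fun j => if j ≤ d + 1 then b j else G (d + 2), fun j hj => if_neg (by omega),
      fun j hj => ?_, ?_⟩
    · rcases hj.eq_or_lt with rfl | hj
      · simp only [le_refl, if_true]
        rw [if_neg (by omega), hb1, hGd]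
      · simp only [if_pos hj.le, if_pos (Nat.succ_le_of_lt hj)]
        refine le_trans ?_ (hbM j (by omega))
        rcases (Nat.le_of_lt_succ hj).eq_or_lt with rfl | hj'
        · rw [Function.update_self, List.length_append]
          omega
        · rw [Function.update_of_ne hj'.ne]
    · rw [Finset.sum_range_succ _ (d + 1), hX, Finset.sum_range_succ _ (d + 1)]
      have h1 : ∑ j ∈ Finset.range (d + 1),
          ((Function.update M d (X ++ M d) j).map (conePoly j)).sum =
          ∑ j ∈ Finset.range (d + 1), ((M j).map (conePoly j)).sum +
            (X.map (conePoly d)).sum := by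
        rw [Finset.sum_range_succ, Finset.sum_range_succ, Function.update_self, List.map_append,
          List.sum_append]
        rw [Finset.sum_congr rfl fun j hj => by
          rw [Function.update_of_ne (Finset.mem_range.1 hj).ne]]
        ring
      have h2 : ∑ j ∈ Finset.range (d + 1), ∑ s ∈ Finset.Ico
          (if j + 1 ≤ d + 1 then b (j + 1) else G (d + 2))
          (if j ≤ d + 1 then b j else G (d + 2)), conePoly j s =
          ∑ j ∈ Finset.range (d + 1), ∑ s ∈ Finset.Ico (b (j + 1)) (b j), conePoly j s := by
        refine Finset.sum_congr rfl fun j hj => ?_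
        have := Finset.mem_range.1 hj
        rw [if_pos (by omega), if_pos (by omega)]
      rw [h2, ← hsum, h1]
      simp only [le_refl, if_true, if_neg (Nat.not_succ_le_self (d + 1)), hb1]
      ring

theorem sum_Ico_conePoly (j : ℕ) {a b : ℕ} (h : a ≤ b) :
    ∑ s ∈ Finset.Ico a b, conePoly j s =
      binomPoly ((j : ℤ) + 1 - a) (j + 1) - binomPoly ((j : ℤ) + 1 - b) (j + 1) := by
  induction b, h using Nat.le_induction with
  | base => simp
  | succ b hb ih =>
    rw [Finset.sum_Ico_succ_top hb, ih, conePoly, ← binomPoly_succ_sub ((j : ℤ) - b) j,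
      show (j : ℤ) - b + 1 = j + 1 - b by ring,
      show (j : ℤ) + 1 - (b + 1 : ℕ) = j - b by push_cast; ring]
    ring

theorem sum_conePoly_eq_add (d : ℕ) (b : ℕ → ℕ) (hb : ∀ j ≤ d, b (j + 1) ≤ b j) :
    ∑ j ∈ Finset.range (d + 1), ∑ s ∈ Finset.Ico (b (j + 1)) (b j), conePoly j s =
      ∑ i ∈ Finset.range (d + 1),
        (binomPoly (i : ℤ) (i + 1) - binomPoly ((i : ℤ) - b i) (i + 1)) +
      (binomPoly ((d : ℤ) + 1 - b (d + 1)) (d + 1) - binomPoly ((d : ℤ) + 1) (d + 1)) := by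
  have key : ∀ j : ℕ, binomPoly ((j : ℤ) + 1 - b j) (j + 1) =
      binomPoly ((j : ℤ) - b j) (j + 1) + binomPoly ((j : ℤ) - b j) j := by
    intro j
    rw [← binomPoly_succ_sub ((j : ℤ) - b j) j, show (j : ℤ) - b j + 1 = j + 1 - b j by ring]
    ring
  have key' : ∀ j : ℕ, binomPoly ((j : ℤ) + 1) (j + 1) =
      binomPoly (j : ℤ) (j + 1) + binomPoly (j : ℤ) j := by
    intro j
    rw [← binomPoly_succ_sub (j : ℤ) j]
    ring
  induction d with
  | zero =>
    rw [Finset.sum_range_one, Finset.sum_range_one, sum_Ico_conePoly 0 (hb 0 le_rfl), key 0,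
      key' 0, binomPoly_zero, binomPoly_zero]
    push_cast
    ring
  | succ d ih =>
    rw [Finset.sum_range_succ, ih fun j hj => hb j (by omega), Finset.sum_range_succ _ (d + 1),
      sum_Ico_conePoly _ (hb _ le_rfl), key (d + 1), key' (d + 1)]
    push_cast
    ring

theorem sum_conePoly_eq (d : ℕ) (b : ℕ → ℕ) (hb : ∀ j ≤ d, b (j + 1) ≤ b j)
    (h0 : b (d + 1) = 0) :
    ∑ j ∈ Finset.range (d + 1), ∑ s ∈ Finset.Ico (b (j + 1)) (b j), conePoly j s =
      ∑ i ∈ Finset.range (d + 1),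
        (binomPoly (i : ℤ) (i + 1) - binomPoly ((i : ℤ) - b i) (i + 1)) := by
  rw [sum_conePoly_eq_add d b hb, h0]
  simp

theorem natDegree_sum_conePoly (d : ℕ) (b : ℕ → ℕ) (hd : 0 < b d) (h0 : b (d + 1) = 0) :
    (∑ j ∈ Finset.range (d + 1),
      ∑ s ∈ Finset.Ico (b (j + 1)) (b j), conePoly j s).natDegree = d := by
  have hle : ∀ j, (∑ s ∈ Finset.Ico (b (j + 1)) (b j), conePoly j s).natDegree ≤ j := fun j =>
    Polynomial.natDegree_sum_le_of_forall_le _ _ fun s _ => natDegree_binomPoly_le _ _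
  refine Polynomial.natDegree_eq_of_le_of_coeff_ne_zero
    (Polynomial.natDegree_sum_le_of_forall_le _ _ fun j hj =>
      (hle j).trans (Nat.le_of_lt_succ (Finset.mem_range.1 hj))) ?_
  rw [Finset.sum_range_succ, Polynomial.coeff_add, Polynomial.finsetSum_coeff,
    Finset.sum_eq_zero fun j hj => Polynomial.coeff_eq_zero_of_natDegree_lt
      ((hle j).trans_lt (Finset.mem_range.1 hj)), zero_add, Polynomial.finsetSum_coeff]
  simp only [conePoly, coeff_binomPoly, Finset.sum_const, Nat.card_Ico, h0, tsub_zero,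
    nsmul_eq_mul]
  positivity

theorem macaulay_sum_injective (d : ℕ) (b b' : ℕ → ℤ)
    (h : ∑ i ∈ Finset.range (d + 1),
        (binomPoly (i : ℤ) (i + 1) - binomPoly ((i : ℤ) - b i) (i + 1)) =
      ∑ i ∈ Finset.range (d + 1),
        (binomPoly (i : ℤ) (i + 1) - binomPoly ((i : ℤ) - b' i) (i + 1))) :
    ∀ i ≤ d, b i = b' i := by
  -- the term `i = 0` is the constant `b 0`
  have hzero : ∀ c : ℤ, binomPoly ((0 : ℕ) : ℤ) (0 + 1) - binomPoly (((0 : ℕ) : ℤ) - c) (0 + 1) =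
      Polynomial.C (c : ℚ) := by
    intro c
    simp [binomPoly]
  have hzero' : ∀ c d : ℤ, Polynomial.C (c : ℚ) = Polynomial.C (d : ℚ) → c = d := fun c d h => by
    exact_mod_cast Polynomial.C_injective h
  induction d generalizing b b' with
  | zero =>
    rw [Finset.sum_range_one, Finset.sum_range_one, hzero, hzero] at h
    intro i hi
    obtain rfl := Nat.le_zero.1 hi
    exact hzero' _ _ h
  | succ d ih =>
    have hdiff : ∀ c : ℕ → ℤ, backwardDiff (∑ i ∈ Finset.range (d + 2),
          (binomPoly (i : ℤ) (i + 1) - binomPoly ((i : ℤ) - c i) (i + 1))) =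
        ∑ i ∈ Finset.range (d + 1),
          (binomPoly (i : ℤ) (i + 1) - binomPoly ((i : ℤ) - c (i + 1)) (i + 1)) := by
      intro c
      rw [backwardDiff_sum, Finset.sum_range_succ', backwardDiff_sub, backwardDiff_binomPoly_succ,
        backwardDiff_binomPoly_succ, binomPoly_zero, binomPoly_zero, sub_self, add_zero]
      refine Finset.sum_congr rfl fun i _ => ?_
      rw [backwardDiff_sub, backwardDiff_binomPoly_succ, backwardDiff_binomPoly_succ]
      congr 2 <;> push_cast <;> ring
    have hsucc := ih (fun i => b (i + 1)) (fun i => b' (i + 1)) <| by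
      rw [← hdiff b, ← hdiff b', h]
    have h0 : b 0 = b' 0 := by
      rw [Finset.sum_range_succ', Finset.sum_range_succ' _ (d + 1), hzero, hzero,
        Finset.sum_congr rfl fun i hi => by
          rw [hsucc i (Nat.le_of_lt_succ (Finset.mem_range.1 hi))]] at h
      exact hzero' _ _ (add_left_cancel h)
    rintro (_ | i) hi
    · exact h0
    · exact hsucc i (Nat.le_of_succ_le_succ hi)

/-! ### Cone decompositions of the ideals `I^{(j)}` -/

section Decomposition

variable {K : Type*} [Field K] {n : ℕ} {U : Set (Fin (n + 1) →₀ ℕ)}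

/-- The exponent set of `I^{(j+1)} R^{(j)}`, for `j ≤ n` and `U` the exponent set of `I`. -/
def extendedShadow (U : Set (Fin (n + 1) →₀ ℕ)) (j : ℕ) : Set (Fin (n - j + 1) →₀ ℕ) :=
  if j < n then shadow U (n - j) (n - (j + 1)) else Set.univ

theorem IsBorel.extendedShadow (hU : IsBorel U) (j : ℕ) : IsBorel (extendedShadow U j) := by
  unfold StronglyStableIdeals.extendedShadow
  split_ifs
  · exact hU.shadow (by omega) (Nat.sub_le n j)
  · exact isBorel_univ

theorem extendedIdealAt_eq_extendedShadow (hU : IsBorel U) {j : ℕ} (hj : j ≤ n) :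
    extendedIdealAt (monomialIdeal U : Ideal (MvPolynomial (Fin (n + 1)) K)) j =
      monomialIdeal (extendedShadow U j) := by
  unfold extendedShadow
  split_ifs with h
  · exact extendedIdealAt_eq hU h
  · obtain rfl : j = n := le_antisymm hj (not_lt.1 h)
    rw [extendedIdealAt_self, monomialIdeal_univ]

theorem complCount_univ {m : ℕ} (k : ℕ) :
    complCount (Set.univ : Set (Fin (m + 1) →₀ ℕ)) k = 0 := by
  simp [complCount]

theorem eq_univ_of_complCount_zero {m : ℕ} {V : Set (Fin (m + 1) →₀ ℕ)} (hV : IsBorel V)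
    (h : complCount V 0 = 0) : V = Set.univ := by
  classical
  rw [complCount_zero] at h
  have h0 : (0 : Fin (m + 1) →₀ ℕ) ∈ V := by
    by_contra hcon
    rw [if_neg hcon] at h
    exact one_ne_zero h
  exact Set.eq_univ_of_forall fun B => hV.mem_of_le h0 zero_le

theorem finite_extendedShadow_diff (hU : IsBorel U) {j : ℕ} (hj : j ≤ n) :
    {A | A ∈ extendedShadow U j ∧ A ∉ shadow U (n - j) (n - j) ∧
      A (Fin.last (n - j)) = 0}.Finite := by
  rcases hj.lt_or_eq with hlt | rfl
  · refine finite_diff (hU.shadow le_rfl (Nat.sub_le n j))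
      (l := ⟨n - (j + 1), by omega⟩) (fun i hi => ?_) fun B hB => ?_
    · have h1 : (i : ℕ) < n - j := Fin.lt_last_iff_ne_last.2 hi
      exact Fin.le_def.2 (show (i : ℕ) ≤ n - (j + 1) by omega)
    · rw [extendedShadow, if_pos hlt] at hB
      obtain ⟨A, hA, hle⟩ := hB
      have hr : n - (j + 1) < n + 1 := by omega
      refine ⟨A ⟨n - (j + 1), hr⟩, A, hA, fun i l hil hi => ?_⟩
      by_cases hir : (i : ℕ) < n - (j + 1)
      · exact (hle i l hil hir).trans (Nat.le_add_right _ _)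
      · have hi' : i = ⟨n - (j + 1), hr⟩ := Fin.ext (show (i : ℕ) = n - (j + 1) by omega)
        have hl : l = ⟨n - (j + 1), by omega⟩ := Fin.ext (show (l : ℕ) = n - (j + 1) by omega)
        rw [hi', hl]
        simp
  · refine (Set.finite_singleton 0).subset fun A hA => ?_
    ext i
    obtain rfl : i = Fin.last (j - j) := Fin.ext (by have := i.2; rw [Fin.val_last]; omega)
    exact hA.2.2

/-- For each `j`, the ideal `I^{(j)}` arises from `I^{(j+1)} R^{(j)}` by expansions of monomials
whose degrees form the list `M j`. -/
theorem exists_degree_lists (hU : IsBorel U) : ∃ M : ℕ → List ℕ, ∀ j ≤ n,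
    ReachedByExpansions (M j).length
      (extendedIdealAt (monomialIdeal U : Ideal (MvPolynomial (Fin (n + 1)) K)) j)
      (idealAt (monomialIdeal U) j) ∧
    (∀ k, complCount (shadow U (n - j) (n - j)) k =
      complCount (extendedShadow U j) k + ((M j).map fun e => coneCount 0 e k).sum) ∧
    ∀ g, GeneratedInDegreeLE (extendedShadow U j) g →
      GrowsByOne g (M j) ∧
        GeneratedInDegreeLE (shadow U (n - j) (n - j)) (g + (M j).length) := by
  have hsub : ∀ j, shadow U (n - j) (n - j) ⊆ extendedShadow U j := by
    intro j
    unfold extendedShadow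
    split_ifs
    · exact shadow_anti (by omega)
    · exact Set.subset_univ _
  choose! M hM using fun (j : ℕ) (hj : j ≤ n) => exists_expansions (K := K) (hU.extendedShadow j)
    (hU.shadow (le_refl (n - j)) (Nat.sub_le n j)) (hsub j) (finite_extendedShadow_diff hU hj)
  refine ⟨M, fun j hj => ?_⟩
  rw [extendedIdealAt_eq_extendedShadow hU hj, idealAt_eq hU hj]
  simpa only [coneCount_zero] using hM j hj

theorem shadow_add_variable (hU : IsBorel U) {m m' r : ℕ} (hm : m' = m + 1) (hr : r ≤ m)
    (hn : m' ≤ n) :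
    (∀ g, GeneratedInDegreeLE (shadow U m r) g → GeneratedInDegreeLE (shadow U m' r) g) ∧
    complCount (shadow U m' r) 0 = complCount (shadow U m r) 0 ∧
    ∀ t, complCount (shadow U m' r) (t + 1) =
      complCount (shadow U m' r) t + complCount (shadow U m r) (t + 1) := by
  subst hm
  have hV : IsBorel (shadow U (m + 1) r) := hU.shadow (by omega) hn
  exact ⟨fun _ => GeneratedInDegreeLE.extend hV (mapDomain_castSucc_mem_shadow_iff hr),
    complCount_extend_zero (mapDomain_castSucc_mem_shadow_iff hr),
    complCount_extend_succ hV (mapDomain_castSucc_mem_shadow_iff hr)⟩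

theorem generatedInDegreeLE_extendedShadow (hU : IsBorel U) {M : ℕ → List ℕ}
    (hM : ∀ j ≤ n, ∀ g, GeneratedInDegreeLE (extendedShadow U j) g →
      GeneratedInDegreeLE (shadow U (n - j) (n - j)) (g + (M j).length)) {j : ℕ} (hj : j ≤ n) :
    GeneratedInDegreeLE (extendedShadow U j) (∑ i ∈ Finset.Ico (j + 1) (n + 1), (M i).length) := by
  induction hj using Nat.decreasingInduction with
  | self =>
    rw [extendedShadow, if_neg (lt_irrefl n)]
    exact fun B _ => ⟨0, trivial, zero_le, by simp⟩
  | of_succ j hj ih =>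
    rw [extendedShadow, if_pos hj, Finset.sum_eq_sum_Ico_succ_bot (Nat.succ_lt_succ hj),
      add_comm (M (j + 1)).length]
    exact (shadow_add_variable hU (by omega) le_rfl (Nat.sub_le n j)).1 _ (hM (j + 1) hj _ ih)

/-- The complement of the exponent set of `I^{(j+1)} R^{(j)}` is counted by cones: each monomial
expanded in `R^{(i)}`, `i > j`, contributes a cone over `i - j + 1` variables. -/
theorem complCount_extendedShadow (hU : IsBorel U) {M : ℕ → List ℕ}
    (hM : ∀ j ≤ n, ∀ k, complCount (shadow U (n - j) (n - j)) k =
      complCount (extendedShadow U j) k + ((M j).map fun e => coneCount 0 e k).sum)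
    {j : ℕ} (hj : j ≤ n) (k : ℕ) :
    complCount (extendedShadow U j) k =
      ∑ i ∈ Finset.Ico (j + 1) (n + 1), ((M i).map fun e => coneCount (i - j) e k).sum := by
  induction hj using Nat.decreasingInduction generalizing k with
  | self => rw [extendedShadow, if_neg (lt_irrefl n), complCount_univ, Finset.Ico_self,
      Finset.sum_empty]
  | of_succ j hj ih =>
    have hshadow : ∀ k, complCount (shadow U (n - (j + 1)) (n - (j + 1))) k =
        ∑ i ∈ Finset.Ico (j + 1) (n + 1),
          ((M i).map fun e => coneCount (i - (j + 1)) e k).sum := by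
      intro k
      rw [hM (j + 1) hj, ih, Finset.sum_eq_sum_Ico_succ_bot (Nat.succ_lt_succ hj), Nat.sub_self,
        add_comm]
    obtain ⟨-, h0, hsucc⟩ := shadow_add_variable hU (r := n - (j + 1)) (m := n - (j + 1))
      (m' := n - j) (by omega) le_rfl (Nat.sub_le n j)
    rw [extendedShadow, if_pos hj]
    have hi : ∀ i ∈ Finset.Ico (j + 1) (n + 1), i - j = i - (j + 1) + 1 := by
      intro i hi
      have := (Finset.mem_Ico.1 hi).1
      omega
    induction k with
    | zero =>
      rw [h0, hshadow]
      refine Finset.sum_congr rfl fun i hi' => ?_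
      rw [hi i hi']
      simp only [coneCount_succ_zero]
    | succ k ihk =>
      rw [hsucc, hshadow, ihk, ← Finset.sum_add_distrib]
      refine Finset.sum_congr rfl fun i hi' => ?_
      rw [hi i hi']
      simp only [coneCount_succ_succ, List.sum_map_add]

theorem complCount_shadow (hU : IsBorel U) {M : ℕ → List ℕ}
    (hM : ∀ j ≤ n, ∀ k, complCount (shadow U (n - j) (n - j)) k =
      complCount (extendedShadow U j) k + ((M j).map fun e => coneCount 0 e k).sum)
    {j : ℕ} (hj : j ≤ n) (k : ℕ) :
    complCount (shadow U (n - j) (n - j)) k =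
      ∑ i ∈ Finset.Ico j (n + 1), ((M i).map fun e => coneCount (i - j) e k).sum := by
  rw [hM j hj, complCount_extendedShadow hU hM hj,
    Finset.sum_eq_sum_Ico_succ_bot (Nat.lt_succ_of_le hj),
    Nat.sub_self, add_comm]

end Decomposition

/-! ### Sums of cone polynomials -/

theorem exists_eval_sum_conePoly (s : Finset ℕ) (M : ℕ → List ℕ) (f : ℕ → ℕ) :
    ∃ k₀ : ℕ, ∀ k : ℕ, k₀ ≤ k → (∑ i ∈ s, ((M i).map (conePoly (f i))).sum).eval (k : ℚ) =
      ((∑ i ∈ s, ((M i).map fun e => coneCount (f i) e k).sum : ℕ) : ℚ) := by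
  obtain ⟨k₀, hk₀⟩ := (s.biUnion fun i => (M i).toFinset).exists_le
  refine ⟨k₀, fun k hk => ?_⟩
  rw [Polynomial.eval_finsetSum, Nat.cast_sum]
  refine Finset.sum_congr rfl fun i hi => ?_
  rw [Polynomial.eval_listSum, Nat.cast_list_sum, List.map_map, List.map_map]
  refine congrArg List.sum (List.map_congr_left fun e he => ?_)
  exact eval_conePoly ((hk₀ e (Finset.mem_biUnion.2 ⟨i, hi, List.mem_toFinset.2 he⟩)).trans hk)

/-- A backward difference removes one variable from each cone, and removes the cones over one
variable altogether. -/
theorem iterate_backwardDiff_sum_conePoly (n : ℕ) (M : ℕ → List ℕ) {j : ℕ} (hj : j ≤ n) :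
    backwardDiff^[j] (∑ i ∈ Finset.Ico 0 (n + 1), ((M i).map (conePoly i)).sum) =
      ∑ i ∈ Finset.Ico j (n + 1), ((M i).map (conePoly (i - j))).sum := by
  have hlist : ∀ (i : ℕ) (L : List ℕ), backwardDiff ((L.map (conePoly i)).sum) =
      (L.map fun e => backwardDiff (conePoly i e)).sum := by
    intro i L
    refine (map_list_sum backwardDiffHom _).trans ?_
    rw [List.map_map]
    rfl
  induction j with
  | zero => rfl
  | succ j ih =>
    rw [Function.iterate_succ_apply', ih (by omega), backwardDiff_sum,
      Finset.sum_eq_sum_Ico_succ_bot (by omega), hlist, Nat.sub_self]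
    have h0 : ((M j).map fun e => backwardDiff (conePoly 0 e)).sum = 0 := by
      simp [conePoly_zero, backwardDiff_one]
    rw [h0, zero_add]
    refine Finset.sum_congr rfl fun i hi => ?_
    have := (Finset.mem_Ico.1 hi).1
    rw [hlist, show i - j = i - (j + 1) + 1 by omega]
    simp only [backwardDiff_conePoly_succ]

theorem eq_of_eventually_eval_eq {p q : Polynomial ℚ} {k₀ : ℕ}
    (h : ∀ k : ℕ, k₀ ≤ k → p.eval (k : ℚ) = q.eval (k : ℚ)) : p = q := by
  refine Polynomial.eq_of_infinite_eval_eq p q ?_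
  refine ((Set.Ici_infinite k₀).image (f := fun k : ℕ => (k : ℚ))
    (Nat.cast_injective.injOn)).mono ?_
  rintro _ ⟨k, hk, rfl⟩
  exact h k hk

end

end StronglyStableIdeals

open StronglyStableIdeals in
theorem theorem4p5 {K : Type*} [Field K] (n d : ℕ)
    (I : Ideal (MvPolynomial (Fin (n + 1)) K)) (hI : I ≠ ⊤)
    (hsat : StronglyStableIdeals.IsSaturated I)
    (hstable : StronglyStableIdeals.IsStronglyStable I)
    (p : Polynomial ℚ) (hp : StronglyStableIdeals.IsHilbertPolynomial I p)
    (hd : p.natDegree = d) :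
    d ≤ n ∧
    -- the process starts with the unit ideal of `R^{(d)}` and ends with `I = I^{(0)}`
    StronglyStableIdeals.extendedIdealAt I d = ⊤ ∧
    StronglyStableIdeals.idealAt I 0 = I ∧
    -- the integers `b_0, …, b_d` exist and are unique; `a_j = b_j - b_{j+1}` (`b_{d+1} = 0`)
    ∃ b : ℕ → ℤ, StronglyStableIdeals.IsMacaulayRepresentation p d b ∧
      (∀ b' : ℕ → ℤ, StronglyStableIdeals.IsMacaulayRepresentation p d b' → b' = b) ∧
      ∃ N : ℕ → ℕ,
        (∀ j ≤ d,
          -- `N j` expansions in `R^{(j)}` take `I^{(j+1)} R^{(j)}` to `I^{(j)}`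
          StronglyStableIdeals.ReachedByExpansions (N j)
            (StronglyStableIdeals.extendedIdealAt I j) (StronglyStableIdeals.idealAt I j) ∧
          -- and no other number of expansions does
          (∀ m : ℕ, StronglyStableIdeals.ReachedByExpansions m
            (StronglyStableIdeals.extendedIdealAt I j) (StronglyStableIdeals.idealAt I j) →
              m = N j) ∧
          (∃ q : Polynomial ℚ,
            StronglyStableIdeals.IsHilbertPolynomial
              (StronglyStableIdeals.extendedIdealAt I j) q ∧
            (N j : Polynomial ℚ) = StronglyStableIdeals.backwardDiff^[j] p - q) ∧
          (N j : ℤ) ≤ b j - b (j + 1)) ∧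
        ∑ j ∈ Finset.range (d + 1), (N j : ℤ) ≤ b 0 := by
  obtain ⟨U, hU, rfl⟩ := exists_isBorel hsat hstable
  obtain ⟨M, hM⟩ := exists_degree_lists (K := K) hU
  have hcount : ∀ j ≤ n, ∀ k, complCount (shadow U (n - j) (n - j)) k =
      complCount (extendedShadow U j) k + ((M j).map fun e => coneCount 0 e k).sum :=
    fun j hj => (hM j hj).2.1
  have hgen : ∀ j ≤ n, GeneratedInDegreeLE (extendedShadow U j)
      (∑ i ∈ Finset.Ico (j + 1) (n + 1), (M i).length) := fun j hj =>
    generatedInDegreeLE_extendedShadow hU (fun j hj g hg => ((hM j hj).2.2 g hg).2) hj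
  have hself : shadow U (n - 0) (n - 0) = U := hU.shadow_self
  -- the Hilbert polynomial as a sum of cone polynomials
  have hpM : p = ∑ i ∈ Finset.Ico 0 (n + 1), ((M i).map (conePoly i)).sum := by
    obtain ⟨k₁, hk₁⟩ := hp
    obtain ⟨k₂, hk₂⟩ := exists_eval_sum_conePoly (Finset.Ico 0 (n + 1)) M id
    refine eq_of_eventually_eval_eq (k₀ := max k₁ k₂) fun k hk => ?_
    rw [hk₁ k (le_of_max_le_left hk), hU.hilbertFunction_eq, ← hself,
      complCount_shadow hU hcount (Nat.zero_le n)]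
    exact (hk₂ k (le_of_max_le_right hk)).symm
  obtain ⟨b, hb0, hbM, hbsum⟩ := exists_rearrangement n M
    (fun j => ∑ i ∈ Finset.Ico j (n + 1), (M i).length)
    (fun j hj => by rw [Finset.sum_eq_sum_Ico_succ_bot (Nat.lt_succ_of_le hj), add_comm])
    (fun j hj => ((hM j hj).2.2 _ (hgen j hj)).1)
  simp only [Finset.Ico_self, Finset.sum_empty] at hb0
  have hanti : ∀ j, b (j + 1) ≤ b j := by
    intro j
    by_cases hj : j ≤ n
    · have := hbM j hj
      omega
    · rw [hb0 (j + 1) (by omega)]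
      exact Nat.zero_le _
  have hanti' : Antitone b := antitone_nat_of_succ_le hanti
  have hnil : ∀ j ≤ n, b j = 0 → M j = [] := fun j hj h => by
    have := hbM j hj
    exact List.length_eq_zero_iff.1 (by omega)
  have hb_pos : 0 < b 0 := by
    by_contra! hcon
    apply hI
    have h0 : complCount U 0 = 0 := by
      rw [← hself, complCount_shadow hU hcount (Nat.zero_le n)]
      refine Finset.sum_eq_zero fun i hi => ?_
      rw [hnil i (Nat.le_of_lt_succ (Finset.mem_Ico.1 hi).2)
        (Nat.le_zero.1 ((hanti' (Nat.zero_le i)).trans hcon))]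
      rfl
    rw [eq_univ_of_complCount_zero hU h0, monomialIdeal_univ]
  -- the degree of `p` is the largest index `D` with `b D > 0`
  obtain ⟨D, hDn, hD, hD0⟩ : ∃ D ≤ n, 0 < b D ∧ ∀ j, D < j → b j = 0 := by
    refine ⟨Nat.findGreatest (fun j => 0 < b j) n, Nat.findGreatest_le n,
      Nat.findGreatest_spec (P := fun j => 0 < b j) (Nat.zero_le n) hb_pos, fun j hj => ?_⟩
    by_cases hjn : j ≤ n
    · exact Nat.eq_zero_of_not_pos (Nat.findGreatest_is_greatest (P := fun j => 0 < b j) hj hjn)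
    · exact hb0 j (by omega)
  have hpD : p = ∑ j ∈ Finset.range (D + 1), ∑ s ∈ Finset.Ico (b (j + 1)) (b j), conePoly j s := by
    rw [hpM, ← Finset.range_eq_Ico, hbsum]
    refine (Finset.sum_subset (Finset.range_mono (by omega)) fun j _ hj => ?_).symm
    rw [Finset.mem_range] at hj
    rw [hD0 j (by omega), hD0 (j + 1) (by omega), Finset.Ico_self, Finset.sum_empty]
  obtain rfl : D = d := by
    rw [← hd, hpD, natDegree_sum_conePoly D b hD (hD0 _ (Nat.lt_succ_self D))]
  have hmac : IsMacaulayRepresentation p D fun j => (b j : ℤ) := by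
    refine ⟨fun j _ => Nat.cast_le.2 (hanti j), Nat.cast_pos.2 hD,
      fun j hj => Nat.cast_eq_zero.2 (hD0 j hj), ?_⟩
    rw [hpD, sum_conePoly_eq D b (fun j _ => hanti j) (hD0 _ (Nat.lt_succ_self D))]
  refine ⟨hDn, ?_, ?_, fun j => (b j : ℤ), hmac, fun b' hb' => ?_, fun j => (M j).length,
    fun j hj => ?_, ?_⟩
  · rw [extendedIdealAt_eq_extendedShadow hU hDn, eq_univ_of_complCount_zero
      (hU.extendedShadow D), monomialIdeal_univ]
    rw [complCount_extendedShadow hU hcount hDn]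
    refine Finset.sum_eq_zero fun i hi => ?_
    rw [hnil i (Nat.le_of_lt_succ (Finset.mem_Ico.1 hi).2) (hD0 i (Finset.mem_Ico.1 hi).1)]
    rfl
  · rw [idealAt_eq hU (Nat.zero_le n)]
    exact congrArg monomialIdeal hself
  · have h := macaulay_sum_injective D b' (fun j => (b j : ℤ))
      (hb'.2.2.2.symm.trans hmac.2.2.2)
    funext i
    by_cases hi : i ≤ D
    · exact h i hi
    · rw [hb'.2.2.1 i (by omega), hD0 i (by omega), Nat.cast_zero]
  · have hjn := hj.trans hDn
    refine ⟨(hM j hjn).1, fun m hm => ?_,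
      ⟨∑ i ∈ Finset.Ico (j + 1) (n + 1), ((M i).map (conePoly (i - j))).sum, ?_, ?_⟩, ?_⟩
    · have hN := (hM j hjn).1
      rw [extendedIdealAt_eq_extendedShadow hU hjn, idealAt_eq hU hjn] at hm hN
      have hW := hU.shadow (le_refl (n - j)) (Nat.sub_le n j)
      obtain ⟨k₁, hk₁⟩ := hm.eventually_complCount (hU.extendedShadow j) hW
      obtain ⟨k₂, hk₂⟩ := hN.eventually_complCount (hU.extendedShadow j) hW
      have h1 := hk₁ _ (le_max_left k₁ k₂)
      have h2 := hk₂ _ (le_max_right k₁ k₂)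
      exact Nat.add_left_cancel (h1.symm.trans h2)
    · obtain ⟨k₀, hk₀⟩ := exists_eval_sum_conePoly (Finset.Ico (j + 1) (n + 1)) M fun i => i - j
      refine ⟨k₀, fun k hk => ?_⟩
      rw [hk₀ k hk, extendedIdealAt_eq_extendedShadow hU hjn,
        (hU.extendedShadow j).hilbertFunction_eq, complCount_extendedShadow hU hcount hjn]
    · rw [hpM, iterate_backwardDiff_sum_conePoly n M hjn,
        Finset.sum_eq_sum_Ico_succ_bot (by omega), add_sub_cancel_right, Nat.sub_self,
        funext conePoly_zero]
      simp
    · have := hbM j hjn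
      push_cast
      omega
  · calc ∑ j ∈ Finset.range (D + 1), ((M j).length : ℤ)
        ≤ ∑ j ∈ Finset.range (D + 1), ((b j : ℤ) - b (j + 1)) := by
          refine Finset.sum_le_sum fun j hj => ?_
          have := hbM j ((Nat.le_of_lt_succ (Finset.mem_range.1 hj)).trans hDn)
          omega
      _ = (b 0 : ℤ) - b (D + 1) := Finset.sum_range_sub' (fun j => (b j : ℤ)) (D + 1)
      _ ≤ b 0 := by omega
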